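/- **Theorem (Model-based MDP with low GEC).** Consider episodic MDPs of horizon $H$ with a measurable state space, an action space, a fixed initial-state distribution, transition densities $\mathbb P_h(x'\mid x,a)$ with respect to a common $\sigma$-finite reference measure, and deterministic rewards $R_h\ge 0$ with $\sum_{h=1}^H R_h\le 1$. For a model $f=(\mathbb P_f,R_f)$ let $V_f$ be its optimal value and $\pi_f$ an optimal Markov policy. Let $f^*$ be the true model, $V^\pi$ the value of $\pi$ in $f^*$, and $V^*=V_{f^*}$. Let $\mathcal H$ be a class of such models, with $(\mathbb P_f,R_f,\pi_f)$ jointly measurable in $f$, that contains $f^*$ (realizability). The exploration policies are either $\pi_{\exp}(f,h)=\pi_f$ (Q-type), or, for a finite action space, $\pi_{\exp}(f,h)$ follows $\pi_f$ for the first $h-1$ steps, takes a uniformly random action at step $h$, and is arbitrary afterwards (V-type). *GEC.* Let $d_{\mathrm{GEC}}$ be the smallest $d\ge 0$ such that for all $f^1,\dots,f^T\in\mathcal H$ $$\sum_{t=1}^T (V_{f^t}-V^{\pi_{f^t}})\le\Big[d\sum_{h=1}^H\sum_{t=1}^T\sum_{s=1}^{t-1}\mathbb E_{\pi_{\exp}(f^s,h)}D_H^2\big(\mathbb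 P_{h,f^t}(\cdot\mid x_h,a_h),\mathbb P_{h,f^*}(\cdot\mid x_h,a_h)\big)\Big]^{1/2}+2\min\{d,HT\}+\epsilon HT,\qquad \epsilon=\frac1{\sqrt{H^2T}},$$ where $D_H^2(P,Q)=\frac12\int(\sqrt{dP}-\sqrt{dQ})^2$ and the expectations are taken in $f^*$. *Prior coverage.* For $c>0$ and a probability measure $p^0$ on $\mathcal H$ let $\omega(c,p^0)=\inf_{\epsilon>0}[c\epsilon-\log p^0(\mathcal H(\epsilon))]$, where $\mathcal H(\epsilon)=\{f\in\mathcal H: V^*-V_f\le\epsilon,\ \sup_{h,x,a}\mathrm{KL}(\mathbb P_{h,f^*}(\cdot\mid x,a)\,\|\,\mathbb P_{h,f}(\cdot\mid x,a))\le\epsilon\}$. *Algorithm.* For $t=1,\dots,T$: sample $f^t$ from the distribution $p^t(f)\propto p^0(f)\exp\big(\gamma V_f+\eta\sum_{s=1}^{t-1}\sum_{h=1}^H\log\mathbb P_{h,f}(x_{h+1}^s\mid x_h^s,a_h^s)\big)$; then for each $h\in[H]$, independently, execute $\pi_{\exp}(f^t,h)$ for one episode in $f^*$ and observe $(x_h^t,a_h^t,r_h^t,x_{h+1}^t)$.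 Let $\mathrm{Reg}(T)=\sum_{t=1}^T(V^*-V^{\pi_{f^t}})$. *Claim.* Let $\eta=1/2$, $\gamma=2\sqrt{\omega(HT,p^0)T/d_{\mathrm{GEC}}}$, and suppose $1\le d_{\mathrm{GEC}}\le T$. 1. If $\frac12\le\omega(HT,p^0)<\infty$, then the algorithm is almost surely well defined (all posteriors normalize) and $$\mathbb E[\mathrm{Reg}(T)]\le 4\sqrt{d_{\mathrm{GEC}}\cdot HT\cdot\omega(HT,p^0)}.$$ 2. If $\mathcal H$ is finite and $p^0$ is the uniform distribution on $\mathcal H$ (with no further condition on $\omega$), then the algorithm is almost surely well defined and $$\mathbb E[\mathrm{Reg}(T)]\le 4\sqrt{d_{\mathrm{GEC}}\cdot HT\cdot\log|\mathcal H|}.$$ Both bounds also hold when the regret is counted over the $N=HT$ executed episodes, each of the $H$ episodes of iteration $t$ incurring $V^*-V^{\pi_{f^t}}$: $H\cdot\mathbb E[\mathrm{Reg}(T)]\le 4\sqrt{d_{\mathrm{GEC}}\cdot H\cdot N\cdot\omega(HT,p^0)}$, respectively $4\sqrt{d_{\mathrm{GEC}}\cdot H\cdot N\cdot\log|\mathcal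 H|}$. -/

import Mathlib

open MeasureTheory ProbabilityTheory
open scoped NNReal ENNReal

noncomputable section

namespace ModelBasedMDP

/-- A (time-inhomogeneous, horizon `H`) Markov decision process on the measurable state space `S`
and action space `A`. Transition kernels are given by densities with respect to a reference
measure `ν` on `S` (counting measure for countable `S`): `dens h x a x'` is
`ℙ_h(x' | x, a)`. Rewards are deterministic, nonnegative, and sum to at most one. Steps are indexed
by `Fin H`, that is, from `0` to `H - 1`. -/
structure MDP (S A : Type*) [MeasurableSpace S] [MeasurableSpace A] (H : ℕ) (ν : Measure S) where
  dens : Fin H → S → A → S → ℝ≥0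
  rew : Fin H → S → A → ℝ
  measurable_dens : ∀ h, Measurable fun z : (S × A) × S => dens h z.1.1 z.1.2 z.2
  lintegral_dens : ∀ h x a, ∫⁻ y, (dens h x a y : ℝ≥0∞) ∂ν = 1
  measurable_rew : ∀ h, Measurable fun z : S × A => rew h z.1 z.2
  rew_nonneg : ∀ h x a, 0 ≤ rew h x a
  sum_rew_le_one : ∀ (x : Fin H → S) (a : Fin H → A), ∑ h, rew h (x h) (a h) ≤ 1

/-- A Markov policy `{π_h : S → Δ(A)}`. -/
structure Policy (S A : Type*) [MeasurableSpace S] [MeasurableSpace A] (H : ℕ) where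
  kernel : Fin H → Kernel S A
  markov : ∀ h, IsMarkovKernel (kernel h)

/-- A model-based hypothesis class: a family of models `f ↦ (ℙ_f, R_f)`, jointly measurable
in the hypothesis (so that there can be prior and posterior distributions on it). -/
structure ModelClass (𝓗 S A : Type*) [MeasurableSpace 𝓗] [MeasurableSpace S] [MeasurableSpace A]
    (H : ℕ) (ν : Measure S) where
  model : 𝓗 → MDP S A H ν
  measurable_dens :
    ∀ h, Measurable fun z : 𝓗 × ((S × A) × S) => (model z.1).dens h z.2.1.1 z.2.1.2 z.2.2
  measurable_rew : ∀ h, Measurable fun z : 𝓗 × (S × A) => (model z.1).rew h z.2.1 z.2.2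

/-- A family of Markov policies indexed measurably by the hypotheses. -/
structure PolicyFamily (𝓗 S A : Type*) [MeasurableSpace 𝓗] [MeasurableSpace S]
    [MeasurableSpace A] (H : ℕ) where
  kernel : Fin H → Kernel (𝓗 × S) A
  markov : ∀ h, IsMarkovKernel (kernel h)

variable {𝓗 S A : Type*} [MeasurableSpace 𝓗] [MeasurableSpace S] [MeasurableSpace A]
  {H : ℕ} {ν : Measure S}

/-- The policy that the family attaches to the hypothesis `f`. -/
def PolicyFamily.policy (π : PolicyFamily 𝓗 S A H) (f : 𝓗) : Policy S A H where
  kernel h := (π.kernel h).sectR f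
  markov h := by
    have := π.markov h
    infer_instance

/-- The transition distribution `ℙ_h(· | x, a)`. -/
def MDP.transLaw (m : MDP S A H ν) (h : Fin H) (z : S × A) : Measure S :=
  ν.withDensity fun y => (m.dens h z.1 z.2 y : ℝ≥0∞)

/-- The law of the state `x_h` when `π` is executed in the model `m` from the initial
distribution `ρ`. -/
def stateLaw (m : MDP S A H ν) (ρ : Measure S) (π : Policy S A H) : ℕ → Measure S
  | 0 => ρ
  | n + 1 =>
    if hn : n < H then (stateLaw m ρ π n ⊗ₘ π.kernel ⟨n, hn⟩).bind (m.transLaw ⟨n, hn⟩) else 0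

/-- The law of the state-action pair `(x_h, a_h)` when `π` is executed in `m`. -/
def stateActionLaw (m : MDP S A H ν) (ρ : Measure S) (π : Policy S A H) (h : Fin H) :
    Measure (S × A) :=
  stateLaw m ρ π h ⊗ₘ π.kernel h

/-- The value `V^π = 𝔼_π [∑_h r_h]` of `π` in the model `m`. -/
def value (m : MDP S A H ν) (ρ : Measure S) (π : Policy S A H) : ℝ :=
  ∑ h, ∫ z, m.rew h z.1 z.2 ∂(stateActionLaw m ρ π h)

/-- The optimal value of the model `m`; this is `V_f` for `m` the model of the hypothesis `f`,
and `V^*` for `m` the true model. -/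
def optValue (m : MDP S A H ν) (ρ : Measure S) : ℝ :=
  sSup (Set.range fun π : Policy S A H => value m ρ π)

/-- `π_f` is an optimal policy of the model `f`, for every hypothesis `f`. -/
def IsOptimalFamily (cls : ModelClass 𝓗 S A H ν) (ρ : Measure S)
    (π : PolicyFamily 𝓗 S A H) : Prop :=
  ∀ (f : 𝓗) (π' : Policy S A H),
    value (cls.model f) ρ π' ≤ value (cls.model f) ρ (π.policy f)

/-- Q-type exploration: `π_exp(f, h) = π_f` for every step `h`. -/
def IsQType (π : PolicyFamily 𝓗 S A H) (πexp : Fin H → PolicyFamily 𝓗 S A H) : Prop :=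
  ∀ h, πexp h = π

/-- V-type exploration, for a finite action space: `π_exp(f, h)` follows `π_f` before step `h`,
takes a uniformly distributed action at step `h`, and is arbitrary afterwards. -/
def IsVType (π : PolicyFamily 𝓗 S A H) (πexp : Fin H → PolicyFamily 𝓗 S A H) : Prop :=
  Finite A ∧ ∀ (h : Fin H) (f : 𝓗) (x : S),
    (∀ i < h, (πexp h).kernel i (f, x) = π.kernel i (f, x)) ∧
    (πexp h).kernel h (f, x) = uniformOn Set.univ

/-- The squared Hellinger distance `D_H²(P, Q) = ½ ∫ (√dP - √dQ)²` of the distributions with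
densities `p` and `q` with respect to `ν`. -/
def hellingerSq (ν : Measure S) (p q : S → ℝ≥0) : ℝ :=
  (1 / 2) * ∫ y, (Real.sqrt (p y) - Real.sqrt (q y)) ^ 2 ∂ν

/-- The expected discrepancy
`𝔼_{π_exp(g, h)} [D_H²(ℙ_{h, f}(· | x_h, a_h), ℙ_{h, f*}(· | x_h, a_h))]`, where the expectation is
taken in the true model. -/
def discrepancy (truth : MDP S A H ν) (cls : ModelClass 𝓗 S A H ν) (ρ : Measure S)
    (πexp : Fin H → PolicyFamily 𝓗 S A H) (h : Fin H) (g f : 𝓗) : ℝ :=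
  ∫ z, hellingerSq ν ((cls.model f).dens h z.1 z.2) (truth.dens h z.1 z.2)
    ∂(stateActionLaw truth ρ ((πexp h).policy g) h)

/-- The Hellinger-based generalized eluder coefficient for `T` rounds, with burn-in cost
`2 min {d, H T} + ε H T`. (The set is closed, so the infimum is its least element.) -/
def gec (truth : MDP S A H ν) (cls : ModelClass 𝓗 S A H ν) (ρ : Measure S)
    (π : PolicyFamily 𝓗 S A H) (πexp : Fin H → PolicyFamily 𝓗 S A H) (T : ℕ) (ε : ℝ) : ℝ :=
  sInf {d : ℝ | 0 ≤ d ∧ ∀ f : Fin T → 𝓗,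
    ∑ t, (optValue (cls.model (f t)) ρ - value truth ρ (π.policy (f t))) ≤
      Real.sqrt (d * ∑ h, ∑ t, ∑ s with s < t, discrepancy truth cls ρ πexp h (f s) (f t))
        + 2 * min d (H * T) + ε * H * T}

/-- The hypotheses `𝓗(ε)` with `V^* - V_f ≤ ε` and
`sup_{h, x, a} KL(ℙ_{h, f*}(· | x, a) ‖ ℙ_{h, f}(· | x, a)) ≤ ε`. -/
def nearTruth (truth : MDP S A H ν) (cls : ModelClass 𝓗 S A H ν) (ρ : Measure S) (ε : ℝ) :
    Set 𝓗 :=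
  {f | optValue truth ρ - optValue (cls.model f) ρ ≤ ε ∧
    ∀ (h : Fin H) (z : S × A),
      InformationTheory.klDiv (truth.transLaw h z) ((cls.model f).transLaw h z)
        ≤ ENNReal.ofReal ε}

/-- The prior coverage `ω(c, p⁰) = inf_{ε > 0} [c ε - log p⁰(𝓗(ε))]`, with `log 0 = -∞`;
it is `⊤` when no `𝓗(ε)` has positive prior mass. -/
def omega (truth : MDP S A H ν) (cls : ModelClass 𝓗 S A H ν) (ρ : Measure S)
    (c : ℝ) (p₀ : Measure 𝓗) : EReal :=
  ⨅ (ε : ℝ) (_ : 0 < ε), (((c * ε : ℝ) : EReal) - ENNReal.log (p₀ (nearTruth truth cls ρ ε)))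

/-- What is produced in one round: the sampled hypothesis `f^t`, and for each step `h` the triple
`((x_h^t, a_h^t), x_{h+1}^t)` observed when `π_exp(f^t, h)` is executed. The reward is a function of
`(x_h^t, a_h^t)` and is not recorded. -/
abbrev Round (𝓗 S A : Type*) (H : ℕ) : Type _ := 𝓗 × (Fin H → (S × A) × S)

/-- The log-likelihood `L_h^s(f) = η log ℙ_{h, f}(x_{h+1}^s | x_h^s, a_h^s)`, in `[-∞, ∞)`. -/
def logLik (cls : ModelClass 𝓗 S A H ν) (η : ℝ) (r : Round 𝓗 S A H) (h : Fin H) (f : 𝓗) :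
    EReal :=
  (η : EReal) *
    ENNReal.log ((cls.model f).dens h (r.2 h).1.1 (r.2 h).1.2 (r.2 h).2 : ℝ≥0∞)

/-- The unnormalized posterior density
`exp (γ V_f + ∑_{s < t} ∑_h L_h^s(f))` relative to the prior. -/
def weight (cls : ModelClass 𝓗 S A H ν) (ρ : Measure S) (γ η : ℝ) {t : ℕ}
    (hist : Fin t → Round 𝓗 S A H) (f : 𝓗) : ℝ≥0∞ :=
  EReal.exp (((γ * optValue (cls.model f) ρ : ℝ) : EReal)
    + ∑ s, ∑ h, logLik cls η (hist s) h f)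

lemma exp_sum {ι : Type*} (s : Finset ι) (g : ι → EReal) :
    EReal.exp (∑ i ∈ s, g i) = ∏ i ∈ s, EReal.exp (g i) := by
  classical
  induction s using Finset.induction_on with
  | empty => simp
  | insert i s hi ih => rw [Finset.sum_insert hi, Finset.prod_insert hi, EReal.exp_add, ih]

lemma weight_eq (cls : ModelClass 𝓗 S A H ν) (ρ : Measure S) (γ η : ℝ) {t : ℕ}
    (hist : Fin t → Round 𝓗 S A H) (f : 𝓗) :
    weight cls ρ γ η hist f = ENNReal.ofReal (Real.exp (γ * optValue (cls.model f) ρ)) *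
      ∏ s, ∏ h, ((cls.model f).dens h ((hist s).2 h).1.1 ((hist s).2 h).1.2 ((hist s).2 h).2
        : ℝ≥0∞) ^ η := by
  simp only [weight, EReal.exp_add, EReal.exp_coe, exp_sum, logLik, ENNReal.rpow_eq_exp_mul_log]

/-- The optimistic posterior `p^t ∝ p⁰(f) exp (γ V_f + ∑_{s < t} ∑_h L_h^s(f))`. -/
def posterior (cls : ModelClass 𝓗 S A H ν) (ρ : Measure S) (γ η : ℝ) (p₀ : Measure 𝓗) {t : ℕ}
    (hist : Fin t → Round 𝓗 S A H) : Measure 𝓗 :=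
  p₀.withDensity fun f => weight cls ρ γ η hist f / ∫⁻ g, weight cls ρ γ η hist g ∂p₀

/-- The law of the data collected in a round in which `f` was sampled: independently for each
step `h`, the policy `π_exp(f, h)` is executed in the true model, and `((x_h, a_h), x_{h+1})` is
observed. -/
def dataLaw (truth : MDP S A H ν) (ρ : Measure S) (πexp : Fin H → PolicyFamily 𝓗 S A H) (f : 𝓗) :
    Measure (Fin H → (S × A) × S) :=
  Measure.pi fun h =>
    (stateActionLaw truth ρ ((πexp h).policy f) h).bind fun z =>
      (truth.transLaw h z).map fun y => (z, y)

/-- The law of the first `t` rounds of the model-based posterior sampling algorithm with prior `p₀`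
and parameters `γ`, `η`: in each round sample `f^t` from the posterior given the past, then collect
the data with the exploration policies `π_exp(f^t, h)`. -/
def runLaw (truth : MDP S A H ν) (cls : ModelClass 𝓗 S A H ν) (ρ : Measure S)
    (πexp : Fin H → PolicyFamily 𝓗 S A H) (γ η : ℝ) (p₀ : Measure 𝓗) :
    (t : ℕ) → Measure (Fin t → Round 𝓗 S A H)
  | 0 => Measure.dirac Fin.elim0
  | t + 1 =>
    (runLaw truth cls ρ πexp γ η p₀ t).bind fun hist =>
      (posterior cls ρ γ η p₀ hist).bind fun f =>
        (dataLaw truth ρ πexp f).map fun D =>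
          (Fin.snoc hist (f, D) : Fin (t + 1) → Round 𝓗 S A H)

/-- `Reg(T) = ∑_{t ≤ T} (V^* - V^{π^t})` with `π^t = π_{f^t}`, along a run. -/
def regret (truth : MDP S A H ν) (ρ : Measure S) (π : PolicyFamily 𝓗 S A H) {T : ℕ}
    (run : Fin T → Round 𝓗 S A H) : ℝ :=
  ∑ t, (optValue truth ρ - value truth ρ (π.policy (run t).1))

/-- The algorithm is almost surely well defined for `T` rounds (every posterior normalizes), and its
regret is integrable. -/
def IsWellDefinedRun (truth : MDP S A H ν) (cls : ModelClass 𝓗 S A H ν) (ρ : Measure S)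
    (π : PolicyFamily 𝓗 S A H) (πexp : Fin H → PolicyFamily 𝓗 S A H) (γ η : ℝ)
    (p₀ : Measure 𝓗) (T : ℕ) : Prop :=
  IsProbabilityMeasure (runLaw truth cls ρ πexp γ η p₀ T) ∧
  Integrable (fun run => regret truth ρ π run) (runLaw truth cls ρ πexp γ η p₀ T)

/-- The expected regret `𝔼[Reg(T)]` of the algorithm. -/
def expectedRegret (truth : MDP S A H ν) (cls : ModelClass 𝓗 S A H ν) (ρ : Measure S)
    (π : PolicyFamily 𝓗 S A H) (πexp : Fin H → PolicyFamily 𝓗 S A H) (γ η : ℝ)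
    (p₀ : Measure 𝓗) (T : ℕ) : ℝ :=
  ∫ run, regret truth ρ π run ∂(runLaw truth cls ρ πexp γ η p₀ T)

end ModelBasedMDP

end

open ModelBasedMDP

open ModelBasedMDP

/-! ### Kernels, measurability in the hypothesis, and bounds on values -/

noncomputable section
namespace ModelBasedMDP

variable {𝓗 S A : Type*} [MeasurableSpace 𝓗] [MeasurableSpace S] [MeasurableSpace A]
  {H : ℕ} {ν : Measure S}

/-! The core is an exponential moment bound for one draw from the posterior. For fixed f, the square
root of the likelihood ratio of f against the truth has conditional mean 1 - D_H² ≤ exp(-D_H²) at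
each step, which is why η = 1/2. Compensating by the exponential of the expected discrepancies gives
a process of mean at most 1 (`lintegral_prod_compensatedRatio_le_one`). Divide the posterior weight
by that of the truth to get `relWeight`, and let the potential of f be γ(V* - V_f) plus the
discrepancies accumulated so far. Then `relWeight` times exp(potential) is exactly this process. So,
with Z the prior integral of `relWeight` and f drawn from the posterior, E[exp(potential) Z] ≤ 1
(`lintegral_exp_potential_mul_le_one`).

Keep in Z only the hypotheses of 𝓗(ε), and apply Jensen jointly to the run, the posterior sample and
an independent draw from the prior conditioned on 𝓗(ε). This yields E[potential] ≤ γε + tHε/2 - log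
p⁰(𝓗(ε)): the optimism gap costs γε, and each of the tH observations costs half a KL divergence
(`integral_potential_le`). If γ + tH/2 ≤ HT, the infimum over ε is at most ω(HT, p⁰), uniformly in
t.

The regret splits into the gaps V* - V_f and the terms V_f - V^π. The GEC inequality controls the
latter, and √(dx) ≤ x/γ + dγ/4 reassembles the potentials (`regret_le`). Hence E[Reg] ≤ Tω/γ + dγ/4
+ 2d + √T, where the chosen γ makes the first two terms √(dTω). If T ≤ 16dω, the trivial bound Reg ≤
T suffices; otherwise γ ≤ T/2, 2d ≤ √(dTω) and √T ≤ 2√(dTω). The result 4√(dTω) is free of H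
(`expectedRegret_le`), and the stated bounds follow from H ≥ 1.

The posteriors normalize by strong induction (`normalizes`): Z is almost surely finite by the
compensated process, and positive because finite KL makes every hypothesis in 𝓗(ε) give positive
density to the data.

For a finite class ω ≤ log |𝓗|, but ω may be below 1/2 or even 0. Therefore `expectedRegret_le`
keeps the ω that defines γ apart from an upper bound ℓ ≥ 1/2. -/

/-- The transition kernels of the models of a class, jointly in the hypothesis. -/
def ModelClass.transKernel [SigmaFinite ν] (cls : ModelClass 𝓗 S A H ν) (h : Fin H) :
    Kernel (𝓗 × (S × A)) S :=
  (Kernel.const _ ν).withDensity fun p y => ((cls.model p.1).dens h p.2.1 p.2.2 y : ℝ≥0∞)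

lemma ModelClass.transKernel_apply [SigmaFinite ν] (cls : ModelClass 𝓗 S A H ν) (h : Fin H)
    (p : 𝓗 × (S × A)) : cls.transKernel h p = (cls.model p.1).transLaw h p.2 := by
  rw [transKernel, Kernel.withDensity_apply, Kernel.const_apply, MDP.transLaw]
  exact ((cls.measurable_dens h).comp (by fun_prop :
    Measurable fun q : (𝓗 × (S × A)) × S => (q.1.1, (q.1.2, q.2)))).coe_nnreal_ennreal

lemma MDP.isProbabilityMeasure_transLaw (m : MDP S A H ν) (h : Fin H) (z : S × A) :
    IsProbabilityMeasure (m.transLaw h z) :=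
  ⟨by rw [MDP.transLaw, withDensity_apply _ MeasurableSet.univ, setLIntegral_univ,
    m.lintegral_dens]⟩

instance [SigmaFinite ν] (cls : ModelClass 𝓗 S A H ν) (h : Fin H) :
    IsMarkovKernel (cls.transKernel h) :=
  ⟨fun p => by rw [cls.transKernel_apply]; exact MDP.isProbabilityMeasure_transLaw _ _ _⟩

/-- The class all of whose models are `m`. -/
def MDP.constClass (m : MDP S A H ν) (𝓗 : Type*) [MeasurableSpace 𝓗] : ModelClass 𝓗 S A H ν where
  model _ := m
  measurable_dens h := (m.measurable_dens h).comp measurable_snd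
  measurable_rew h := (m.measurable_rew h).comp measurable_snd

/-- The transition kernel of a model. -/
def MDP.transKernel (m : MDP S A H ν) (h : Fin H) [SigmaFinite ν] : Kernel (S × A) S :=
  ((m.constClass Unit).transKernel h).sectR ()

lemma MDP.transKernel_apply [SigmaFinite ν] (m : MDP S A H ν) (h : Fin H) (z : S × A) :
    m.transKernel h z = m.transLaw h z :=
  (m.constClass Unit).transKernel_apply h ((), z)

lemma MDP.coe_transKernel [SigmaFinite ν] (m : MDP S A H ν) (h : Fin H) :
    ⇑(m.transKernel h) = m.transLaw h :=
  funext (m.transKernel_apply h)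

instance [SigmaFinite ν] (m : MDP S A H ν) (h : Fin H) : IsMarkovKernel (m.transKernel h) := by
  unfold MDP.transKernel; infer_instance

instance (π : Policy S A H) (h : Fin H) : IsMarkovKernel (π.kernel h) := π.markov h

instance (π : PolicyFamily 𝓗 S A H) (h : Fin H) : IsMarkovKernel (π.kernel h) := π.markov h

lemma isProbabilityMeasure_stateLaw [SigmaFinite ν] (m : MDP S A H ν) (ρ : Measure S)
    [IsProbabilityMeasure ρ] (π : Policy S A H) (n : ℕ) (hn : n ≤ H) :
    IsProbabilityMeasure (stateLaw m ρ π n) := by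
  induction n with
  | zero => simpa [stateLaw]
  | succ n ih =>
    have := ih (by omega)
    rw [stateLaw, dif_pos (by omega), ← m.coe_transKernel]
    infer_instance

instance [SigmaFinite ν] (m : MDP S A H ν) (ρ : Measure S) [IsProbabilityMeasure ρ]
    (π : Policy S A H) (h : Fin H) : IsProbabilityMeasure (stateActionLaw m ρ π h) := by
  have := isProbabilityMeasure_stateLaw m ρ π h h.2.le
  unfold stateActionLaw
  infer_instance

/-- Model and policy vary with f together, so each step of the recursion is the marginal of a
composition of jointly measurable kernels. Taking `truth.constClass` as the class covers a fixed
model with varying policy. -/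
lemma measurable_stateLaw [SigmaFinite ν] (cls : ModelClass 𝓗 S A H ν) (ρ : Measure S)
    [IsProbabilityMeasure ρ] (π : PolicyFamily 𝓗 S A H) (n : ℕ) (hn : n ≤ H) :
    Measurable fun f => stateLaw (cls.model f) ρ (π.policy f) n := by
  induction n with
  | zero => exact measurable_const
  | succ n ih =>
    let κ : Kernel 𝓗 S := ⟨_, ih (by omega)⟩
    have : IsMarkovKernel κ :=
      ⟨fun f => isProbabilityMeasure_stateLaw (cls.model f) ρ (π.policy f) n (by omega)⟩
    have h : (fun f => stateLaw (cls.model f) ρ (π.policy f) (n + 1)) =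
        ((κ ⊗ₖ π.kernel ⟨n, hn⟩) ⊗ₖ cls.transKernel ⟨n, hn⟩).snd := by
      funext f
      rw [Kernel.snd_apply, Kernel.compProd_apply_eq_compProd_sectR,
        Kernel.compProd_apply_eq_compProd_sectR, ← Measure.snd, Measure.snd_compProd, stateLaw,
        dif_pos (show n < H from hn)]
      congr 1
      funext z
      rw [Kernel.sectR_apply, cls.transKernel_apply]
    rw [h]
    exact Kernel.measurable _

/-- The kernel from hypotheses to the laws of the state-action pair at step `h`. -/
def stateActionKernel [SigmaFinite ν] (cls : ModelClass 𝓗 S A H ν) (ρ : Measure S)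
    [IsProbabilityMeasure ρ] (π : PolicyFamily 𝓗 S A H) (h : Fin H) : Kernel 𝓗 (S × A) where
  toFun f := stateActionLaw (cls.model f) ρ (π.policy f) h
  measurable' := by
    let κ : Kernel 𝓗 S := ⟨_, measurable_stateLaw cls ρ π h h.2.le⟩
    have : IsMarkovKernel κ :=
      ⟨fun f => isProbabilityMeasure_stateLaw (cls.model f) ρ (π.policy f) h h.2.le⟩
    have h' : (fun f => stateActionLaw (cls.model f) ρ (π.policy f) h) = (κ ⊗ₖ π.kernel h) := by
      funext f
      rw [Kernel.compProd_apply_eq_compProd_sectR]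
      rfl
    rw [h']
    exact Kernel.measurable _

instance [SigmaFinite ν] (cls : ModelClass 𝓗 S A H ν) (ρ : Measure S)
    [IsProbabilityMeasure ρ] (π : PolicyFamily 𝓗 S A H) (h : Fin H) :
    IsMarkovKernel (stateActionKernel cls ρ π h) :=
  ⟨fun f => inferInstanceAs
    (IsProbabilityMeasure (stateActionLaw (cls.model f) ρ (π.policy f) h))⟩

lemma measurable_value [SigmaFinite ν] (cls : ModelClass 𝓗 S A H ν) (ρ : Measure S)
    [IsProbabilityMeasure ρ] (π : PolicyFamily 𝓗 S A H) :
    Measurable fun f => value (cls.model f) ρ (π.policy f) := by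
  unfold value
  refine Finset.measurable_sum _ fun h _ => ?_
  exact (StronglyMeasurable.integral_kernel_prod_right' (κ := stateActionKernel cls ρ π h)
    (cls.measurable_rew h).stronglyMeasurable).measurable

lemma MDP.rew_le_one (m : MDP S A H ν) (h : Fin H) (z : S × A) : m.rew h z.1 z.2 ≤ 1 :=
  (Finset.single_le_sum (f := fun i => m.rew i z.1 z.2) (fun i _ => m.rew_nonneg i _ _)
    (Finset.mem_univ h)).trans (m.sum_rew_le_one (fun _ => z.1) fun _ => z.2)

lemma MDP.integrable_rew (m : MDP S A H ν) (h : Fin H) (μ : Measure (S × A)) [IsFiniteMeasure μ] :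
    Integrable (fun z => m.rew h z.1 z.2) μ :=
  .of_bound (m.measurable_rew h).aestronglyMeasurable 1 (.of_forall fun z => by
    rw [Real.norm_of_nonneg (m.rew_nonneg _ _ _)]; exact m.rew_le_one h z)

lemma value_nonneg (m : MDP S A H ν) (ρ : Measure S) (π : Policy S A H) : 0 ≤ value m ρ π :=
  Finset.sum_nonneg fun h _ => integral_nonneg fun _ => m.rew_nonneg h _ _

/-- The value depends only on the marginals of the state-action pairs, so the trajectory law may be
replaced by the product of the marginals. The reward bound holds for all sequences and can then be
integrated pointwise. -/
lemma value_le_one [SigmaFinite ν] (m : MDP S A H ν) (ρ : Measure S) [IsProbabilityMeasure ρ]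
    (π : Policy S A H) : value m ρ π ≤ 1 := by
  have h0 (h : Fin H) : Integrable (fun z : Fin H → S × A => m.rew h (z h).1 (z h).2)
      (Measure.pi fun h => stateActionLaw m ρ π h) :=
    integrable_comp_eval (μ := fun h => stateActionLaw m ρ π h) (f := fun z : S × A => m.rew h z.1 z.2) (m.integrable_rew h _)
  have h1 : value m ρ π = ∫ z : Fin H → S × A, ∑ h, m.rew h (z h).1 (z h).2
      ∂(Measure.pi fun h => stateActionLaw m ρ π h) := by
    rw [integral_finsetSum _ fun h _ => h0 h, value]
    exact Finset.sum_congr rfl fun h _ =>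
      (integral_comp_eval (μ := fun h => stateActionLaw m ρ π h)
        (f := fun z : S × A => m.rew h z.1 z.2) (m.measurable_rew h).aestronglyMeasurable).symm
  rw [h1]
  calc _ ≤ ∫ z : Fin H → S × A, (1 : ℝ) ∂(Measure.pi fun h => stateActionLaw m ρ π h) :=
        integral_mono (integrable_finsetSum _ fun h _ => h0 h) (integrable_const _)
          fun z => m.sum_rew_le_one (fun h => (z h).1) fun h => (z h).2
    _ = 1 := by simp

lemma optValue_nonneg (m : MDP S A H ν) (ρ : Measure S) : 0 ≤ optValue m ρ :=
  Real.sSup_nonneg (by rintro _ ⟨π, rfl⟩; exact value_nonneg m ρ π)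

lemma optValue_le_one [SigmaFinite ν] (m : MDP S A H ν) (ρ : Measure S) [IsProbabilityMeasure ρ] :
    optValue m ρ ≤ 1 :=
  Real.sSup_le (by rintro _ ⟨π, rfl⟩; exact value_le_one m ρ π) zero_le_one

lemma IsOptimalFamily.optValue_eq {cls : ModelClass 𝓗 S A H ν} {ρ : Measure S}
    {π : PolicyFamily 𝓗 S A H} (hπ : IsOptimalFamily cls ρ π) (f : 𝓗) :
    optValue (cls.model f) ρ = value (cls.model f) ρ (π.policy f) :=
  IsGreatest.csSup_eq ⟨⟨_, rfl⟩, by rintro _ ⟨π', rfl⟩; exact hπ f π'⟩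

/-- The supremum over all policies is attained by a policy that is measurable in f, which avoids
measurability of an uncountable supremum. -/
lemma IsOptimalFamily.measurable_optValue [SigmaFinite ν] {cls : ModelClass 𝓗 S A H ν}
    {ρ : Measure S} [IsProbabilityMeasure ρ] {π : PolicyFamily 𝓗 S A H}
    (hπ : IsOptimalFamily cls ρ π) : Measurable fun f => optValue (cls.model f) ρ := by
  simp_rw [hπ.optValue_eq]
  exact measurable_value cls ρ π

end ModelBasedMDP
end

/-! ### Hellinger affinity and the likelihood ratio of one round -/

noncomputable section
namespace ModelBasedMDP

section Auxiliary

variable {α β : Type*} [MeasurableSpace α] [MeasurableSpace β]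

/-- The laws in the model are written with bare `Measure.bind`; in the form `⊗ₘ` they are accessible
to Fubini for kernels. -/
lemma bind_map_prodMk (μ : Measure α) [SFinite μ] (κ : Kernel α β) [IsSFiniteKernel κ] :
    μ.bind (fun z => (κ z).map fun y => (z, y)) = μ ⊗ₘ κ := by
  have hm : Measurable fun z => (κ z).map fun y => (z, y) := by
    refine Measure.measurable_of_measurable_coe _ fun s hs => ?_
    simp_rw [Measure.map_apply measurable_prodMk_left hs]
    exact Kernel.measurable_kernel_prodMk_left hs
  ext s hs
  rw [Measure.bind_apply hs hm.aemeasurable, Measure.compProd_apply hs]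
  simp_rw [Measure.map_apply measurable_prodMk_left hs]

/-- The product of finitely many Markov kernels with the same source. -/
def piKernel {ι : Type*} [Fintype ι] (κ : ι → Kernel α β) [∀ i, IsMarkovKernel (κ i)] :
    Kernel α (ι → β) where
  toFun a := Measure.pi fun i => κ i a
  measurable' := by
    refine Measurable.measure_of_isPiSystem_of_isProbabilityMeasure generateFrom_pi.symm
      isPiSystem_pi ?_
    rintro _ ⟨s, hs, rfl⟩
    simp_rw [Measure.pi_pi]
    exact Finset.measurable_prod _ fun i _ => (κ i).measurable_coe (hs i (Set.mem_univ i))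

instance {ι : Type*} [Fintype ι] (κ : ι → Kernel α β) [∀ i, IsMarkovKernel (κ i)] :
    IsMarkovKernel (piKernel κ) :=
  ⟨fun a => inferInstanceAs (IsProbabilityMeasure (Measure.pi fun i => κ i a))⟩

lemma lintegral_pi_prod {ι : Type*} [Fintype ι] (μ : ι → Measure β) [∀ i, IsProbabilityMeasure (μ i)]
    (F : ι → β → ℝ≥0∞) (hF : ∀ i, Measurable (F i)) :
    ∫⁻ x, ∏ i, F i (x i) ∂(Measure.pi μ) = ∏ i, ∫⁻ y, F i y ∂(μ i) := by
  rw [lintegral_prod_eq_prod_lintegral_of_indepFun Finset.univ (fun i (x : ι → β) => F i (x i))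
    (iIndepFun_pi (X := F) fun i => (hF i).aemeasurable) fun i => (hF i).comp (measurable_pi_apply i)]
  refine Finset.prod_congr rfl fun i _ => ?_
  rw [← (measurePreserving_eval μ i).map_eq, lintegral_map (hF i) (measurable_pi_apply i)]

end Auxiliary

variable {𝓗 S A : Type*} [MeasurableSpace 𝓗] [MeasurableSpace S] [MeasurableSpace A]
  {H : ℕ} {ν : Measure S}

section Hellinger

variable {p q : S → ℝ≥0}

lemma integrable_density (hp : Measurable p) (hp1 : ∫⁻ y, (p y : ℝ≥0∞) ∂ν = 1) :
    Integrable (fun y => (p y : ℝ)) ν :=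
  ⟨hp.coe_nnreal_real.aestronglyMeasurable, by
    simp [HasFiniteIntegral, hp1]⟩

lemma integral_density (hp : Measurable p) (hp1 : ∫⁻ y, (p y : ℝ≥0∞) ∂ν = 1) :
    ∫ y, (p y : ℝ) ∂ν = 1 := by
  rw [integral_eq_lintegral_of_nonneg_ae (.of_forall fun y => NNReal.coe_nonneg (p y))
    hp.coe_nnreal_real.aestronglyMeasurable]
  simp [hp1]

lemma integrable_sqrt_mul_sqrt (hp : Measurable p) (hq : Measurable q)
    (hp1 : ∫⁻ y, (p y : ℝ≥0∞) ∂ν = 1) (hq1 : ∫⁻ y, (q y : ℝ≥0∞) ∂ν = 1) :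
    Integrable (fun y => Real.sqrt (p y) * Real.sqrt (q y)) ν := by
  refine Integrable.mono' ((integrable_density hp hp1).add (integrable_density hq hq1))
    (hp.coe_nnreal_real.sqrt.mul hq.coe_nnreal_real.sqrt).aestronglyMeasurable
    (.of_forall fun y => ?_)
  have h1 := Real.sq_sqrt (NNReal.coe_nonneg (p y))
  have h2 := Real.sq_sqrt (NNReal.coe_nonneg (q y))
  rw [Real.norm_of_nonneg (by positivity), Pi.add_apply]
  nlinarith [sq_nonneg (Real.sqrt (p y) - Real.sqrt (q y)), NNReal.coe_nonneg (p y), NNReal.coe_nonneg (q y)]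

lemma hellingerSq_eq (hp : Measurable p) (hq : Measurable q)
    (hp1 : ∫⁻ y, (p y : ℝ≥0∞) ∂ν = 1) (hq1 : ∫⁻ y, (q y : ℝ≥0∞) ∂ν = 1) :
    hellingerSq ν p q = 1 - ∫ y, Real.sqrt (p y) * Real.sqrt (q y) ∂ν := by
  have h (y : S) : (Real.sqrt (p y) - Real.sqrt (q y)) ^ 2
      = ((p y : ℝ) + q y) - 2 * (Real.sqrt (p y) * Real.sqrt (q y)) := by
    rw [sub_sq, Real.sq_sqrt (NNReal.coe_nonneg (p y)), Real.sq_sqrt (NNReal.coe_nonneg (q y))]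
    ring
  simp_rw [hellingerSq, h]
  have hs := integrable_sqrt_mul_sqrt hp hq hp1 hq1
  have hpq : Integrable (fun y => (p y : ℝ) + q y) ν :=
    (integrable_density hp hp1).add (integrable_density hq hq1)
  rw [integral_sub hpq (hs.const_mul 2),
    integral_add (integrable_density hp hp1) (integrable_density hq hq1), integral_density hp hp1,
    integral_density hq hq1, integral_const_mul]
  ring

lemma hellingerSq_nonneg (p q : S → ℝ≥0) : 0 ≤ hellingerSq ν p q :=
  mul_nonneg (by norm_num) (integral_nonneg fun _ => sq_nonneg _)

lemma hellingerSq_le_one (hp : Measurable p) (hq : Measurable q)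
    (hp1 : ∫⁻ y, (p y : ℝ≥0∞) ∂ν = 1) (hq1 : ∫⁻ y, (q y : ℝ≥0∞) ∂ν = 1) :
    hellingerSq ν p q ≤ 1 := by
  rw [hellingerSq_eq hp hq hp1 hq1, sub_le_self_iff]
  exact integral_nonneg fun _ => by positivity

lemma lintegral_sqrt_div (hp : Measurable p) (hq : Measurable q)
    (hp1 : ∫⁻ y, (p y : ℝ≥0∞) ∂ν = 1) (hq1 : ∫⁻ y, (q y : ℝ≥0∞) ∂ν = 1) :
    ∫⁻ y, (NNReal.sqrt (p y / q y) : ℝ≥0∞) ∂(ν.withDensity fun y => (q y : ℝ≥0∞))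
      = ENNReal.ofReal (1 - hellingerSq ν p q) := by
  have hm : Measurable fun y => (NNReal.sqrt (p y / q y) : ℝ≥0∞) :=
    (NNReal.continuous_sqrt.measurable.comp (hp.div hq)).coe_nnreal_ennreal
  rw [lintegral_withDensity_eq_lintegral_mul _ hq.coe_nnreal_ennreal hm, hellingerSq_eq hp hq hp1 hq1,
    sub_sub_cancel, ofReal_integral_eq_lintegral_ofReal (integrable_sqrt_mul_sqrt hp hq hp1 hq1)
      (.of_forall fun y => by positivity)]
  refine lintegral_congr fun y => ?_
  have h : q y * NNReal.sqrt (p y / q y) = NNReal.sqrt (p y) * NNReal.sqrt (q y) := by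
    -- Where q vanishes, division gives the ratio 0, and the affinity integrand is 0 as well; so p
    -- need not be absolutely continuous with respect to q.
    rcases eq_or_ne (q y) 0 with h0 | h0
    · simp [h0]
    · rw [NNReal.sqrt_div]
      nth_rw 1 [← NNReal.mul_self_sqrt (q y)]
      have : NNReal.sqrt (q y) ≠ 0 := by simpa using h0
      field_simp
  rw [Pi.mul_apply, ← ENNReal.coe_mul, h, ← Real.coe_sqrt, ← Real.coe_sqrt, ← NNReal.coe_mul,
    ENNReal.ofReal_coe_nnreal]

end Hellinger

lemma MDP.measurable_dens_apply (m : MDP S A H ν) (h : Fin H) (x : S) (a : A) :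
    Measurable (m.dens h x a) :=
  (m.measurable_dens h).comp (measurable_prodMk_left (x := (x, a)))

/-- The likelihood ratio of the model of `f` and the true model. -/
def ratio (truth : MDP S A H ν) (cls : ModelClass 𝓗 S A H ν) (h : Fin H) (f : 𝓗)
    (w : (S × A) × S) : ℝ≥0 :=
  (cls.model f).dens h w.1.1 w.1.2 w.2 / truth.dens h w.1.1 w.1.2 w.2

lemma measurable_ratio (truth : MDP S A H ν) (cls : ModelClass 𝓗 S A H ν) (h : Fin H) :
    Measurable fun p : 𝓗 × ((S × A) × S) => ratio truth cls h p.1 p.2 :=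
  (cls.measurable_dens h).div ((truth.measurable_dens h).comp measurable_snd)

lemma measurable_ratio_apply (truth : MDP S A H ν) (cls : ModelClass 𝓗 S A H ν) (h : Fin H)
    (f : 𝓗) : Measurable (ratio truth cls h f) :=
  (measurable_ratio truth cls h).comp measurable_prodMk_left

lemma discrepancy_nonneg (truth : MDP S A H ν) (cls : ModelClass 𝓗 S A H ν) (ρ : Measure S)
    (πexp : Fin H → PolicyFamily 𝓗 S A H) (h : Fin H) (g f : 𝓗) : 0 ≤ discrepancy truth cls ρ πexp h g f :=
  integral_nonneg fun _ => hellingerSq_nonneg _ _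

section SigmaFinite

variable [SigmaFinite ν]

/-- The law of `((x_h, a_h), x_{h+1})` when `π_exp(f, h)` is executed in the true model. -/
def stepKernel (truth : MDP S A H ν) (ρ : Measure S) [IsProbabilityMeasure ρ]
    (πexp : Fin H → PolicyFamily 𝓗 S A H) (h : Fin H) : Kernel 𝓗 ((S × A) × S) :=
  stateActionKernel (truth.constClass 𝓗) ρ (πexp h) h ⊗ₖ (truth.transKernel h).prodMkLeft 𝓗

instance (truth : MDP S A H ν) (ρ : Measure S) [IsProbabilityMeasure ρ]
    (πexp : Fin H → PolicyFamily 𝓗 S A H) (h : Fin H) :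
    IsMarkovKernel (stepKernel truth ρ πexp h) := by
  unfold stepKernel; infer_instance

lemma stepKernel_apply (truth : MDP S A H ν) (ρ : Measure S) [IsProbabilityMeasure ρ]
    (πexp : Fin H → PolicyFamily 𝓗 S A H) (h : Fin H) (f : 𝓗) :
    stepKernel truth ρ πexp h f =
      stateActionLaw truth ρ ((πexp h).policy f) h ⊗ₘ truth.transKernel h := by
  rw [stepKernel, Kernel.compProd_apply_eq_compProd_sectR]
  rfl

/-- The law of the data of a round, as a kernel from the sampled hypothesis. -/
def dataKernel (truth : MDP S A H ν) (ρ : Measure S) [IsProbabilityMeasure ρ]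
    (πexp : Fin H → PolicyFamily 𝓗 S A H) : Kernel 𝓗 (Fin H → (S × A) × S) :=
  piKernel (stepKernel truth ρ πexp)

instance (truth : MDP S A H ν) (ρ : Measure S) [IsProbabilityMeasure ρ]
    (πexp : Fin H → PolicyFamily 𝓗 S A H) : IsMarkovKernel (dataKernel truth ρ πexp) := by
  unfold dataKernel; infer_instance

lemma dataKernel_apply_eq_pi (truth : MDP S A H ν) (ρ : Measure S) [IsProbabilityMeasure ρ]
    (πexp : Fin H → PolicyFamily 𝓗 S A H) (f : 𝓗) :
    dataKernel truth ρ πexp f = Measure.pi fun h => stepKernel truth ρ πexp h f := rfl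

lemma dataKernel_apply (truth : MDP S A H ν) (ρ : Measure S) [IsProbabilityMeasure ρ]
    (πexp : Fin H → PolicyFamily 𝓗 S A H) (f : 𝓗) :
    dataKernel truth ρ πexp f = dataLaw truth ρ πexp f := by
  rw [dataKernel_apply_eq_pi, dataLaw]
  congr 1
  funext h
  rw [stepKernel_apply, ← bind_map_prodMk, truth.coe_transKernel]

lemma measurable_hellingerSq (truth : MDP S A H ν) (cls : ModelClass 𝓗 S A H ν) (h : Fin H) :
    Measurable fun p : 𝓗 × (S × A) =>
      hellingerSq ν ((cls.model p.1).dens h p.2.1 p.2.2) (truth.dens h p.2.1 p.2.2) := by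
  refine Measurable.const_mul (StronglyMeasurable.integral_prod_right'
    (f := fun q : (𝓗 × (S × A)) × S => (Real.sqrt ((cls.model q.1.1).dens h q.1.2.1 q.1.2.2 q.2)
      - Real.sqrt (truth.dens h q.1.2.1 q.1.2.2 q.2)) ^ 2) ?_).measurable _
  have h1 : Measurable fun q : (𝓗 × (S × A)) × S =>
      (cls.model q.1.1).dens h q.1.2.1 q.1.2.2 q.2 := (cls.measurable_dens h).comp
    (by fun_prop : Measurable fun q : (𝓗 × (S × A)) × S => (q.1.1, (q.1.2, q.2)))
  have h2 : Measurable fun q : (𝓗 × (S × A)) × S =>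
      truth.dens h q.1.2.1 q.1.2.2 q.2 := (truth.measurable_dens h).comp
    (by fun_prop : Measurable fun q : (𝓗 × (S × A)) × S => (q.1.2, q.2))
  exact ((h1.coe_nnreal_real.sqrt.sub h2.coe_nnreal_real.sqrt).pow_const 2).stronglyMeasurable

section Discrepancy

variable (truth : MDP S A H ν) (cls : ModelClass 𝓗 S A H ν) (ρ : Measure S)
  (πexp : Fin H → PolicyFamily 𝓗 S A H) (h : Fin H)

lemma measurable_discrepancy [IsProbabilityMeasure ρ] :
    Measurable fun p : 𝓗 × 𝓗 => discrepancy truth cls ρ πexp h p.1 p.2 := by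
  refine (StronglyMeasurable.integral_kernel_prod_right'
    (κ := (stateActionKernel (truth.constClass 𝓗) ρ (πexp h) h).prodMkRight 𝓗)
    (f := fun q : (𝓗 × 𝓗) × (S × A) =>
      hellingerSq ν ((cls.model q.1.2).dens h q.2.1 q.2.2) (truth.dens h q.2.1 q.2.2))
      ?_).measurable
  exact ((measurable_hellingerSq truth cls h).comp
    (by fun_prop : Measurable fun q : (𝓗 × 𝓗) × (S × A) => (q.1.2, q.2))).stronglyMeasurable

lemma integrable_hellingerSq [IsProbabilityMeasure ρ] (g f : 𝓗) :
    Integrable (fun z : S × A =>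
      hellingerSq ν ((cls.model f).dens h z.1 z.2) (truth.dens h z.1 z.2))
      (stateActionLaw truth ρ ((πexp h).policy g) h) :=
  .of_bound ((measurable_hellingerSq truth cls h).comp measurable_prodMk_left).aestronglyMeasurable
    1 (.of_forall fun z => by
    rw [Real.norm_of_nonneg (hellingerSq_nonneg _ _)]
    exact hellingerSq_le_one (MDP.measurable_dens_apply _ _ _ _) (MDP.measurable_dens_apply _ _ _ _)
      (MDP.lintegral_dens _ _ _ _) (MDP.lintegral_dens _ _ _ _))

lemma discrepancy_le_one [IsProbabilityMeasure ρ] (g f : 𝓗) :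
    discrepancy truth cls ρ πexp h g f ≤ 1 := by
  calc _ ≤ ∫ _, (1 : ℝ) ∂(stateActionLaw truth ρ ((πexp h).policy g) h) :=
        integral_mono (integrable_hellingerSq truth cls ρ πexp h g f) (integrable_const _) fun z =>
          hellingerSq_le_one (MDP.measurable_dens_apply _ _ _ _)
            (MDP.measurable_dens_apply _ _ _ _) (MDP.lintegral_dens _ _ _ _)
            (MDP.lintegral_dens _ _ _ _)
    _ = 1 := by simp

/-- Under the true transition the mean of √(P_f/P_*) is the Hellinger affinity; averaging over the
state-action pair turns 1 - D_H² into 1 - discrepancy. -/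
lemma lintegral_sqrt_ratio [IsProbabilityMeasure ρ] (g f : 𝓗) :
    ∫⁻ w, (NNReal.sqrt (ratio truth cls h f w) : ℝ≥0∞) ∂(stepKernel truth ρ πexp h g)
      = ENNReal.ofReal (1 - discrepancy truth cls ρ πexp h g f) := by
  rw [stepKernel_apply, Measure.lintegral_compProd
    (f := fun w => (NNReal.sqrt (ratio truth cls h f w) : ℝ≥0∞))
    (NNReal.continuous_sqrt.measurable.comp (measurable_ratio_apply truth cls h f)
      ).coe_nnreal_ennreal]
  have h1 (z : S × A) := lintegral_sqrt_div (ν := ν)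
    ((cls.model f).measurable_dens_apply h z.1 z.2) (truth.measurable_dens_apply h z.1 z.2)
    (MDP.lintegral_dens _ _ _ _) (MDP.lintegral_dens _ _ _ _)
  simp_rw [truth.transKernel_apply, MDP.transLaw, ratio, h1]
  have hi := integrable_hellingerSq truth cls ρ πexp h g f
  have hi' : Integrable (fun z : S × A =>
      1 - hellingerSq ν ((cls.model f).dens h z.1 z.2) (truth.dens h z.1 z.2))
      (stateActionLaw truth ρ ((πexp h).policy g) h) := (integrable_const 1).sub hi
  rw [← ofReal_integral_eq_lintegral_ofReal hi'
    (.of_forall fun z => sub_nonneg.2 (hellingerSq_le_one (MDP.measurable_dens_apply _ _ _ _)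
            (MDP.measurable_dens_apply _ _ _ _) (MDP.lintegral_dens _ _ _ _)
            (MDP.lintegral_dens _ _ _ _))), integral_sub (integrable_const 1) hi]
  simp [discrepancy]

end Discrepancy

end SigmaFinite

section RoundFactor

variable (truth : MDP S A H ν) (cls : ModelClass 𝓗 S A H ν) (ρ : Measure S)
  (πexp : Fin H → PolicyFamily 𝓗 S A H)

/-- The square root of the likelihood ratio of the data of a round. -/
def sqrtRatio (r : Round 𝓗 S A H) (f : 𝓗) : ℝ≥0∞ :=
  ∏ h, (NNReal.sqrt (ratio truth cls h f (r.2 h)) : ℝ≥0∞)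

/-- The total expected discrepancy of `f` in a round. -/
def roundDiscrepancy (r : Round 𝓗 S A H) (f : 𝓗) : ℝ :=
  ∑ h, discrepancy truth cls ρ πexp h r.1 f

/-- The likelihood ratio factor of a round, compensated by its expected discrepancy. -/
def compensatedRatio (f : 𝓗) (r : Round 𝓗 S A H) : ℝ≥0∞ :=
  ENNReal.ofReal (Real.exp (roundDiscrepancy truth cls ρ πexp r f)) * sqrtRatio truth cls r f

lemma measurable_sqrtRatio :
    Measurable fun p : Round 𝓗 S A H × 𝓗 => sqrtRatio truth cls p.1 p.2 := by
  refine Finset.measurable_fun_prod _ fun h _ => ?_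
  exact (NNReal.continuous_sqrt.measurable.comp ((measurable_ratio truth cls h).comp
    (by fun_prop : Measurable fun p : Round 𝓗 S A H × 𝓗 => (p.2, p.1.2 h)))).coe_nnreal_ennreal

lemma roundDiscrepancy_nonneg (r : Round 𝓗 S A H) (f : 𝓗) :
    0 ≤ roundDiscrepancy truth cls ρ πexp r f :=
  Finset.sum_nonneg fun h _ => discrepancy_nonneg truth cls ρ πexp h _ _

variable [SigmaFinite ν] [IsProbabilityMeasure ρ]

lemma measurable_roundDiscrepancy :
    Measurable fun p : Round 𝓗 S A H × 𝓗 => roundDiscrepancy truth cls ρ πexp p.1 p.2 :=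
  Finset.measurable_fun_sum _ fun h _ => (measurable_discrepancy truth cls ρ πexp h).comp
    (by fun_prop : Measurable fun p : Round 𝓗 S A H × 𝓗 => (p.1.1, p.2))

lemma roundDiscrepancy_le (r : Round 𝓗 S A H) (f : 𝓗) :
    roundDiscrepancy truth cls ρ πexp r f ≤ H :=
  (Finset.sum_le_sum fun h _ => discrepancy_le_one truth cls ρ πexp h r.1 f).trans (by simp)

/-- The H episodes of a round are independent, so the mean factorizes over the steps. Each factor is
exp(D)(1 - D) ≤ exp(D) exp(-D) = 1. -/
lemma lintegral_compensatedRatio_le_one (g f : 𝓗) :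
    ∫⁻ D, compensatedRatio truth cls ρ πexp f (g, D) ∂(dataKernel truth ρ πexp g) ≤ 1 := by
  have hm (h : Fin H) : Measurable fun w => (NNReal.sqrt (ratio truth cls h f w) : ℝ≥0∞) :=
    (NNReal.continuous_sqrt.measurable.comp (measurable_ratio_apply truth cls h f)
      ).coe_nnreal_ennreal
  simp_rw [compensatedRatio, roundDiscrepancy, sqrtRatio, Real.exp_sum,
    ENNReal.ofReal_prod_of_nonneg fun i (_ : i ∈ Finset.univ) =>
      (Real.exp_pos (discrepancy truth cls ρ πexp i g f)).le, ← Finset.prod_mul_distrib]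
  rw [dataKernel_apply_eq_pi, lintegral_pi_prod _
    (fun h w => ENNReal.ofReal (Real.exp (discrepancy truth cls ρ πexp h g f)) *
      (NNReal.sqrt (ratio truth cls h f w) : ℝ≥0∞)) fun h => (hm h).const_mul _]
  refine Finset.prod_le_one' fun h _ => ?_
  rw [lintegral_const_mul _ (hm h), lintegral_sqrt_ratio, ← ENNReal.ofReal_mul (Real.exp_pos _).le,
    ← ENNReal.ofReal_one]
  refine ENNReal.ofReal_le_ofReal ?_
  calc _ ≤ Real.exp (discrepancy truth cls ρ πexp h g f)
        * Real.exp (-discrepancy truth cls ρ πexp h g f) := by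
        gcongr
        linarith [Real.add_one_le_exp (-discrepancy truth cls ρ πexp h g f)]
    _ = 1 := by rw [← Real.exp_add]; simp

lemma measurable_compensatedRatio :
    Measurable fun p : Round 𝓗 S A H × 𝓗 => compensatedRatio truth cls ρ πexp p.2 p.1 :=
  (Real.measurable_exp.comp (measurable_roundDiscrepancy truth cls ρ πexp)).ennreal_ofReal.mul
    (measurable_sqrtRatio truth cls)

lemma measurable_compensatedRatio_apply (f : 𝓗) :
    Measurable fun r => compensatedRatio truth cls ρ πexp f r := by
  have h1 : Measurable fun r : Round 𝓗 S A H => (r, f) := by fun_prop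
  have h2 := (measurable_compensatedRatio truth cls ρ πexp).comp h1
  exact h2

end RoundFactor

end ModelBasedMDP

/-! ### Posterior and run as kernels; the exponential supermartingale -/

noncomputable section
namespace ModelBasedMDP

section Auxiliary

variable {α β δ : Type*} [MeasurableSpace α] [MeasurableSpace β] [MeasurableSpace δ]

lemma bind_map_eq_map_compProd (μ : Measure α) [SFinite μ] (κ : Kernel α β) [IsSFiniteKernel κ]
    {g : α × β → δ} (hg : Measurable g) :
    μ.bind (fun a => (κ a).map fun b => g (a, b)) = (μ ⊗ₘ κ).map g := by
  have hm : Measurable fun a => (κ a).map fun b => g (a, b) := by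
    refine Measure.measurable_of_measurable_coe _ fun s hs => ?_
    have h (a : α) : (κ a).map (fun b => g (a, b)) s = κ a (Prod.mk a ⁻¹' (g ⁻¹' s)) :=
      Measure.map_apply (hg.comp measurable_prodMk_left) hs
    simp_rw [h]
    exact Kernel.measurable_kernel_prodMk_left (hg hs)
  ext s hs
  rw [Measure.bind_apply hs hm.aemeasurable, Measure.map_apply hg hs,
    Measure.compProd_apply (hg hs)]
  exact lintegral_congr fun a => Measure.map_apply (hg.comp measurable_prodMk_left) hs

lemma measurable_finSnoc (t : ℕ) :
    Measurable fun p : (Fin t → α) × α => (Fin.snoc p.1 p.2 : Fin (t + 1) → α) := by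
  rw [measurable_pi_iff]
  intro i
  induction i using Fin.lastCases with
  | last => simpa using measurable_snd
  | cast i => simpa [Function.comp_def] using (measurable_pi_apply i).comp measurable_fst

end Auxiliary

variable {𝓗 S A : Type*} [MeasurableSpace 𝓗] [MeasurableSpace S] [MeasurableSpace A]
  {H : ℕ} {ν : Measure S}

section Posterior

variable (cls : ModelClass 𝓗 S A H ν) (ρ : Measure S) (γ η : ℝ) (p₀ : Measure 𝓗)

lemma measurable_weight (hV : Measurable fun f => optValue (cls.model f) ρ) (t : ℕ) :
    Measurable fun p : (Fin t → Round 𝓗 S A H) × 𝓗 => weight cls ρ γ η p.1 p.2 := by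
  simp_rw [weight_eq]
  refine Measurable.mul ?_ ?_
  · exact (Real.measurable_exp.comp ((hV.comp measurable_snd).const_mul γ)).ennreal_ofReal
  · refine Finset.measurable_prod _ fun s _ => Finset.measurable_prod _ fun h _ => ?_
    refine (Measurable.coe_nnreal_ennreal ?_).pow_const η
    exact (cls.measurable_dens h).comp (by fun_prop :
      Measurable fun p : (Fin t → Round 𝓗 S A H) × 𝓗 => (p.2, (p.1 s).2 h))

lemma posterior_univ (hV : Measurable fun f => optValue (cls.model f) ρ) {t : ℕ}
    (hist : Fin t → Round 𝓗 S A H) : posterior cls ρ γ η p₀ hist Set.univ =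
      (∫⁻ f, weight cls ρ γ η hist f ∂p₀) / ∫⁻ f, weight cls ρ γ η hist f ∂p₀ := by
  rw [posterior, withDensity_apply _ MeasurableSet.univ, setLIntegral_univ]
  simp_rw [div_eq_mul_inv]
  have hm : Measurable (weight cls ρ γ η hist) :=
    Measurable.of_uncurry_left (f := fun (hist : Fin t → Round 𝓗 S A H) f =>
      weight cls ρ γ η hist f) (measurable_weight cls ρ γ η hV t)
  rw [lintegral_mul_const _ hm]

/-- In `ℝ≥0∞` both 0/0 and ∞/∞ are 0, so a failed normalization produces mass 0. The run law is thus
always a subprobability, and the supermartingale bound is available before normalization is known.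
-/
lemma posterior_univ_le_one (hV : Measurable fun f => optValue (cls.model f) ρ) {t : ℕ}
    (hist : Fin t → Round 𝓗 S A H) : posterior cls ρ γ η p₀ hist Set.univ ≤ 1 := by
  rw [posterior_univ cls ρ γ η p₀ hV]
  exact ENNReal.div_self_le_one

variable [IsProbabilityMeasure p₀]

lemma measurable_posteriorDensity (hV : Measurable fun f => optValue (cls.model f) ρ) (t : ℕ) :
    Measurable (Function.uncurry fun (hist : Fin t → Round 𝓗 S A H) f =>
      weight cls ρ γ η hist f / ∫⁻ g, weight cls ρ γ η hist g ∂p₀) :=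
  (measurable_weight cls ρ γ η hV t).div
    ((measurable_weight cls ρ γ η hV t).lintegral_prod_right'.comp measurable_fst)

/-- The posterior as a kernel from histories to hypotheses. -/
def posteriorKernel (hV : Measurable fun f => optValue (cls.model f) ρ) (t : ℕ) :
    Kernel (Fin t → Round 𝓗 S A H) 𝓗 where
  toFun := posterior cls ρ γ η p₀
  measurable' := by
    have h : posterior cls ρ γ η p₀ = (Kernel.const _ p₀).withDensity
        (fun (hist : Fin t → Round 𝓗 S A H) f =>
          weight cls ρ γ η hist f / ∫⁻ g, weight cls ρ γ η hist g ∂p₀) := by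
      funext hist
      rw [Kernel.withDensity_apply _ (measurable_posteriorDensity cls ρ γ η p₀ hV t)]
      rfl
    rw [h]
    exact Kernel.measurable _

lemma posteriorKernel_apply (hV : Measurable fun f => optValue (cls.model f) ρ) (t : ℕ)
    (hist : Fin t → Round 𝓗 S A H) :
    posteriorKernel cls ρ γ η p₀ hV t hist = posterior cls ρ γ η p₀ hist := rfl

instance (hV : Measurable fun f => optValue (cls.model f) ρ) (t : ℕ) :
    IsFiniteKernel (posteriorKernel cls ρ γ η p₀ hV t) :=
  ⟨1, ENNReal.one_lt_top, fun hist => posterior_univ_le_one cls ρ γ η p₀ hV hist⟩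

end Posterior

section Run

variable [SigmaFinite ν] (truth : MDP S A H ν) (cls : ModelClass 𝓗 S A H ν) (ρ : Measure S)
  [IsProbabilityMeasure ρ] (πexp : Fin H → PolicyFamily 𝓗 S A H) (γ η : ℝ) (p₀ : Measure 𝓗)
  [IsProbabilityMeasure p₀]

/-- The law of a round given the history. -/
def roundKernel (hV : Measurable fun f => optValue (cls.model f) ρ)
    (t : ℕ) : Kernel (Fin t → Round 𝓗 S A H) (Round 𝓗 S A H) :=
  posteriorKernel cls ρ γ η p₀ hV t ⊗ₖ (dataKernel truth ρ πexp).prodMkLeft _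

instance (hV : Measurable fun f => optValue (cls.model f) ρ) (t : ℕ) : IsFiniteKernel (roundKernel truth cls ρ πexp γ η p₀ hV t) := by
  unfold roundKernel; infer_instance

lemma roundKernel_apply
    (hV : Measurable fun f => optValue (cls.model f) ρ) (t : ℕ) (hist : Fin t → Round 𝓗 S A H) :
    roundKernel truth cls ρ πexp γ η p₀ hV t hist =
      posteriorKernel cls ρ γ η p₀ hV t hist ⊗ₘ dataKernel truth ρ πexp := by
  rw [roundKernel, Kernel.compProd_apply_eq_compProd_sectR]
  rfl

/-- The s-finiteness assumption is needed to form `⊗ₘ`. It is discharged by an induction that uses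
this very formula, after which `runLaw_succ` holds unconditionally. -/
lemma runLaw_succ_of_sFinite
    (hV : Measurable fun f => optValue (cls.model f) ρ) (t : ℕ) [SFinite (runLaw truth cls ρ πexp γ η p₀ t)] :
    runLaw truth cls ρ πexp γ η p₀ (t + 1) =
      (runLaw truth cls ρ πexp γ η p₀ t ⊗ₘ roundKernel truth cls ρ πexp γ η p₀ hV t).map
        fun p => Fin.snoc p.1 p.2 := by
  rw [← bind_map_eq_map_compProd _ _ (measurable_finSnoc t), runLaw]
  congr 1
  funext hist
  simp_rw [← dataKernel_apply]
  rw [roundKernel_apply, posteriorKernel_apply]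
  have := posterior_univ_le_one cls ρ γ η p₀ hV hist
  have : IsFiniteMeasure (posterior cls ρ γ η p₀ hist) := ⟨this.trans_lt ENNReal.one_lt_top⟩
  exact bind_map_eq_map_compProd _ _
    ((measurable_finSnoc t).comp (measurable_prodMk_left (x := hist)))

lemma isFiniteMeasure_runLaw
    (hV : Measurable fun f => optValue (cls.model f) ρ) (t : ℕ) : IsFiniteMeasure (runLaw truth cls ρ πexp γ η p₀ t) := by
  induction t with
  | zero => rw [runLaw]; infer_instance
  | succ t ih => rw [runLaw_succ_of_sFinite truth cls ρ πexp γ η p₀ hV t]; infer_instance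

lemma runLaw_succ
    (hV : Measurable fun f => optValue (cls.model f) ρ) (t : ℕ) :
    runLaw truth cls ρ πexp γ η p₀ (t + 1) =
      (runLaw truth cls ρ πexp γ η p₀ t ⊗ₘ roundKernel truth cls ρ πexp γ η p₀ hV t).map
        fun p => Fin.snoc p.1 p.2 := by
  have := isFiniteMeasure_runLaw truth cls ρ πexp γ η p₀ hV t
  exact runLaw_succ_of_sFinite truth cls ρ πexp γ η p₀ hV t

lemma lintegral_runLaw_succ
    (hV : Measurable fun f => optValue (cls.model f) ρ) (t : ℕ) {F : (Fin (t + 1) → Round 𝓗 S A H) → ℝ≥0∞}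
    (hF : Measurable F) :
    ∫⁻ run, F run ∂(runLaw truth cls ρ πexp γ η p₀ (t + 1)) =
      ∫⁻ hist, ∫⁻ f, ∫⁻ D, F (Fin.snoc hist (f, D)) ∂(dataKernel truth ρ πexp f)
        ∂(posterior cls ρ γ η p₀ hist) ∂(runLaw truth cls ρ πexp γ η p₀ t) := by
  have := isFiniteMeasure_runLaw truth cls ρ πexp γ η p₀ hV t
  rw [runLaw_succ truth cls ρ πexp γ η p₀ hV, lintegral_map hF (measurable_finSnoc t),
    Measure.lintegral_compProd (f := fun p => F (Fin.snoc p.1 p.2))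
      (hF.comp (measurable_finSnoc t))]
  refine lintegral_congr fun hist => ?_
  rw [roundKernel_apply]
  exact Measure.lintegral_compProd ((hF.comp (measurable_finSnoc t)).comp measurable_prodMk_left)

/-- Exponential supermartingale bound for the likelihood ratios. -/
lemma lintegral_prod_compensatedRatio_le_one
    (hV : Measurable fun f => optValue (cls.model f) ρ) (f : 𝓗) (t : ℕ) :
    ∫⁻ hist, ∏ s, compensatedRatio truth cls ρ πexp f (hist s)
      ∂(runLaw truth cls ρ πexp γ η p₀ t) ≤ 1 := by
  have hF := measurable_compensatedRatio_apply truth cls ρ πexp f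
  induction t with
  | zero => simp [runLaw]
  | succ t ih =>
    rw [lintegral_runLaw_succ truth cls ρ πexp γ η p₀ hV t
      (F := fun hist => ∏ s, compensatedRatio truth cls ρ πexp f (hist s))
      (Finset.measurable_fun_prod _ fun s _ => hF.comp (measurable_pi_apply s))]
    refine le_trans (lintegral_mono fun hist => ?_) ih
    simp only [Fin.prod_univ_castSucc, Fin.snoc_castSucc, Fin.snoc_last]
    have hc (g : 𝓗) : ∫⁻ D, (∏ s, compensatedRatio truth cls ρ πexp f (hist s)) *
          compensatedRatio truth cls ρ πexp f (g, D) ∂(dataKernel truth ρ πexp g)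
        ≤ ∏ s, compensatedRatio truth cls ρ πexp f (hist s) := by
      have hF' := hF.comp (measurable_prodMk_left (x := g))
      simp only [Function.comp_def] at hF'
      rw [lintegral_const_mul _ hF']
      exact mul_le_of_le_one_right zero_le
        (lintegral_compensatedRatio_le_one truth cls ρ πexp g f)
    refine (lintegral_mono hc).trans ?_
    rw [lintegral_const]
    exact mul_le_of_le_one_right zero_le (posterior_univ_le_one cls ρ γ η p₀ hV hist)

/-- The posterior at time `t` is almost surely a probability measure. -/
def Normalizes (t : ℕ) : Prop :=
  ∀ᵐ hist ∂(runLaw truth cls ρ πexp γ η p₀ t), posterior cls ρ γ η p₀ hist Set.univ = 1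

variable {truth cls ρ πexp γ η p₀}

lemma isProbabilityMeasure_runLaw
    (hV : Measurable fun f => optValue (cls.model f) ρ) (t : ℕ)
    (hn : ∀ u < t, Normalizes truth cls ρ πexp γ η p₀ u) :
    IsProbabilityMeasure (runLaw truth cls ρ πexp γ η p₀ t) := by
  induction t with
  | zero => rw [runLaw]; infer_instance
  | succ t ih =>
    have := ih fun u hu => hn u (by omega)
    refine ⟨?_⟩
    rw [← lintegral_one, lintegral_runLaw_succ truth cls ρ πexp γ η p₀ hV t measurable_const]
    simp only [lintegral_one, measure_univ]
    rw [lintegral_congr_ae (hn t (by omega))]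
    simp

/-- The law of what is observed at step `h` in round `s` is a mixture of step laws. -/
lemma exists_map_runLaw_eq_comp
    (hV : Measurable fun f => optValue (cls.model f) ρ) (t : ℕ) (hn : ∀ u < t, Normalizes truth cls ρ πexp γ η p₀ u)
    (s : Fin t) (h : Fin H) : ∃ mix : Measure 𝓗, IsProbabilityMeasure mix ∧
      (runLaw truth cls ρ πexp γ η p₀ t).map (fun run => (run s).2 h) =
        mix.bind (stepKernel truth ρ πexp h) := by
  induction t with
  | zero => exact s.elim0
  | succ t ih =>
    have hn' : ∀ u < t, Normalizes truth cls ρ πexp γ η p₀ u := fun u hu => hn u (by omega)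
    have hP := isProbabilityMeasure_runLaw hV t hn'
    have hm (s : Fin (t + 1)) : Measurable fun run : Fin (t + 1) → Round 𝓗 S A H => (run s).2 h :=
      by fun_prop
    have hN := hn t (by omega)
    induction s using Fin.lastCases with
    | last =>
      -- The mixing law is the marginal law of the hypothesis sampled in the last round.
      refine ⟨posteriorKernel cls ρ γ η p₀ hV t ∘ₘ runLaw truth cls ρ πexp γ η p₀ t, ⟨?_⟩, ?_⟩
      · rw [Measure.bind_apply MeasurableSet.univ (Kernel.aemeasurable _)]
        simp_rw [posteriorKernel_apply]
        rw [lintegral_congr_ae hN]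
        simp
      · ext B hB
        rw [← lintegral_indicator_one hB, lintegral_map (measurable_one.indicator hB) (hm _),
          lintegral_runLaw_succ truth cls ρ πexp γ η p₀ hV t
            (F := fun run => B.indicator 1 ((run (Fin.last t)).2 h))
            ((measurable_one.indicator hB).comp (hm _)),
          Measure.bind_apply hB (Kernel.aemeasurable _),
          Measure.lintegral_bind (Kernel.aemeasurable _)
            (Kernel.measurable_coe _ hB).aemeasurable]
        refine lintegral_congr fun hist => lintegral_congr fun f => ?_
        simp only [Fin.snoc_last]
        rw [dataKernel_apply_eq_pi]
        have hmp := measurePreserving_eval (fun h => stepKernel truth ρ πexp h f) h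
        rw [← hmp.map_eq, Measure.map_apply (measurable_pi_apply h) hB,
          ← lintegral_indicator_one (measurable_pi_apply h hB)]
        rfl
    | cast s =>
      obtain ⟨mix, hmix, heq⟩ := ih hn' s
      refine ⟨mix, hmix, ?_⟩
      rw [← heq]
      ext B hB
      have hm' : Measurable fun run : Fin t → Round 𝓗 S A H => (run s).2 h := by fun_prop
      rw [← lintegral_indicator_one hB, lintegral_map (measurable_one.indicator hB) (hm _),
        lintegral_runLaw_succ truth cls ρ πexp γ η p₀ hV t
          (F := fun run => B.indicator 1 ((run s.castSucc).2 h))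
          ((measurable_one.indicator hB).comp (hm _)), ← lintegral_indicator_one hB,
        lintegral_map (measurable_one.indicator hB) hm']
      -- For an earlier round, the additional last round integrates out with mass one; this is where
      -- normalization enters.
      refine lintegral_congr_ae ?_
      filter_upwards [hN] with hist hh
      simp [hh]

end Run

end ModelBasedMDP
end

/-! ### Weights relative to the truth; normalization of the posteriors -/

noncomputable section
namespace ModelBasedMDP

variable {𝓗 S A : Type*} [MeasurableSpace S] [MeasurableSpace A] {H : ℕ} {ν : Measure S}

section ReferenceWeight

variable (truth : MDP S A H ν) (ρ : Measure S) (γ : ℝ)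

/-- The weight of the true model. -/
def refWeight {t : ℕ} (hist : Fin t → Round 𝓗 S A H) : ℝ≥0∞ :=
  ENNReal.ofReal (Real.exp (γ * optValue truth ρ)) *
    ∏ s, ∏ h, (NNReal.sqrt (truth.dens h ((hist s).2 h).1.1 ((hist s).2 h).1.2 ((hist s).2 h).2)
      : ℝ≥0∞)

lemma refWeight_ne_top {t : ℕ} (hist : Fin t → Round 𝓗 S A H) : refWeight truth ρ γ hist ≠ ∞ :=
  ENNReal.mul_ne_top ENNReal.ofReal_ne_top
    (ENNReal.prod_ne_top fun _ _ => ENNReal.prod_ne_top fun _ _ => ENNReal.coe_ne_top)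

lemma refWeight_ne_zero {t : ℕ} {hist : Fin t → Round 𝓗 S A H}
    (hpos : ∀ s h, truth.dens h ((hist s).2 h).1.1 ((hist s).2 h).1.2 ((hist s).2 h).2 ≠ 0) :
    refWeight truth ρ γ hist ≠ 0 := by
  refine mul_ne_zero (by simp [Real.exp_pos]) ?_
  exact Finset.prod_ne_zero_iff.2 fun s _ => Finset.prod_ne_zero_iff.2 fun h _ => by
    simpa using hpos s h

end ReferenceWeight

variable [MeasurableSpace 𝓗]

section Weights

variable (truth : MDP S A H ν) (cls : ModelClass 𝓗 S A H ν) (ρ : Measure S) (γ : ℝ)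

/-- The weight of a hypothesis relative to that of the true model. -/
def relWeight {t : ℕ} (hist : Fin t → Round 𝓗 S A H) (f : 𝓗) : ℝ≥0∞ :=
  ENNReal.ofReal (Real.exp (γ * (optValue (cls.model f) ρ - optValue truth ρ))) *
    ∏ s, sqrtRatio truth cls (hist s) f

/-- The factor belonging to the truth does not depend on f and cancels in the posterior. Positivity
of the true densities along the history is what undoes the division in `ratio`. -/
lemma weight_eq_refWeight_mul_relWeight {t : ℕ} {hist : Fin t → Round 𝓗 S A H}
    (hpos : ∀ s h, truth.dens h ((hist s).2 h).1.1 ((hist s).2 h).1.2 ((hist s).2 h).2 ≠ 0)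
    (f : 𝓗) : weight cls ρ γ (1 / 2) hist f =
      refWeight truth ρ γ hist * relWeight truth cls ρ γ hist f := by
  rw [weight_eq, refWeight, relWeight, mul_mul_mul_comm, ← ENNReal.ofReal_mul (Real.exp_pos _).le,
    ← Real.exp_add, ← Finset.prod_mul_distrib]
  congr 1
  · ring_nf
  · refine Finset.prod_congr rfl fun s _ => ?_
    rw [sqrtRatio, ← Finset.prod_mul_distrib]
    refine Finset.prod_congr rfl fun h _ => ?_
    rw [← ENNReal.coe_mul, ← NNReal.sqrt_mul, ratio, mul_div_cancel₀ _ (hpos s h),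
      NNReal.sqrt_eq_rpow, ENNReal.coe_rpow_of_nonneg _ (by norm_num)]

lemma measurable_prod_sqrtRatio (t : ℕ) : Measurable fun p : (Fin t → Round 𝓗 S A H) × 𝓗 =>
    ∏ s, sqrtRatio truth cls (p.1 s) p.2 := by
  refine Finset.measurable_fun_prod _ fun s _ => ?_
  have h1 : Measurable fun p : (Fin t → Round 𝓗 S A H) × 𝓗 => (p.1 s, p.2) := by fun_prop
  have h2 := (measurable_sqrtRatio truth cls).comp h1
  exact h2

lemma measurable_relWeight (hV : Measurable fun f => optValue (cls.model f) ρ) (t : ℕ) :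
    Measurable fun p : (Fin t → Round 𝓗 S A H) × 𝓗 => relWeight truth cls ρ γ p.1 p.2 :=
  ((Real.measurable_exp.comp (((hV.comp measurable_snd).sub_const _).const_mul γ)).ennreal_ofReal
    ).mul (measurable_prod_sqrtRatio truth cls t)

lemma measurable_relWeight_apply (hV : Measurable fun f => optValue (cls.model f) ρ) {t : ℕ}
    (hist : Fin t → Round 𝓗 S A H) : Measurable fun f => relWeight truth cls ρ γ hist f :=
  Measurable.of_uncurry_left (f := fun (hist : Fin t → Round 𝓗 S A H) f =>
    relWeight truth cls ρ γ hist f) (measurable_relWeight truth cls ρ γ hV t)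

lemma sqrtRatio_le_compensatedRatio (πexp : Fin H → PolicyFamily 𝓗 S A H) (r : Round 𝓗 S A H)
    (f : 𝓗) : sqrtRatio truth cls r f ≤ compensatedRatio truth cls ρ πexp f r := by
  refine le_mul_of_one_le_left zero_le ?_
  rw [← ENNReal.ofReal_one]
  exact ENNReal.ofReal_le_ofReal
    (Real.one_le_exp (roundDiscrepancy_nonneg truth cls ρ πexp r f))

lemma measurableSet_ratio_pos (t : ℕ) : MeasurableSet {p : 𝓗 × (Fin t → Round 𝓗 S A H) |
    ∀ s h, 0 < ratio truth cls h p.1 ((p.2 s).2 h)} := by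
  simp only [Set.ofPred_forall]
  refine MeasurableSet.iInter fun s => MeasurableSet.iInter fun h => ?_
  have h1 : Measurable fun p : 𝓗 × (Fin t → Round 𝓗 S A H) => (p.1, (p.2 s).2 h) := by fun_prop
  exact ((measurable_ratio truth cls h).comp h1) measurableSet_Ioi

end Weights

variable [SigmaFinite ν] (truth : MDP S A H ν) (cls : ModelClass 𝓗 S A H ν) (ρ : Measure S)
  [IsProbabilityMeasure ρ] (πexp : Fin H → PolicyFamily 𝓗 S A H) (γ : ℝ) (p₀ : Measure 𝓗)
  [IsProbabilityMeasure p₀]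

lemma abs_optValue_sub_le_one (m m' : MDP S A H ν) :
    |optValue m ρ - optValue m' ρ| ≤ 1 :=
  abs_le.2 ⟨by linarith [optValue_nonneg m ρ, optValue_le_one m' ρ],
    by linarith [optValue_nonneg m' ρ, optValue_le_one m ρ]⟩

/-- All optimal values lie in [0, 1], so the optimism factor is at most exp |γ|, and discrepancies
are nonnegative. This reduces finiteness of the normalizer to the supermartingale bound. -/
lemma relWeight_le {t : ℕ} (hist : Fin t → Round 𝓗 S A H) (f : 𝓗) :
    relWeight truth cls ρ γ hist f ≤
      ENNReal.ofReal (Real.exp |γ|) * ∏ s, compensatedRatio truth cls ρ πexp f (hist s) := by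
  refine mul_le_mul' (ENNReal.ofReal_le_ofReal (Real.exp_le_exp.2 ?_))
    (Finset.prod_le_prod' fun s _ => sqrtRatio_le_compensatedRatio truth cls ρ πexp _ _)
  refine (le_abs_self _).trans ?_
  rw [abs_mul]
  exact mul_le_of_le_one_right (abs_nonneg _) (abs_optValue_sub_le_one ρ _ _)

lemma measurable_prod_compensatedRatio (t : ℕ) :
    Measurable fun p : (Fin t → Round 𝓗 S A H) × 𝓗 =>
      ∏ s, compensatedRatio truth cls ρ πexp p.2 (p.1 s) := by
  refine Finset.measurable_fun_prod _ fun s _ => ?_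
  have h1 : Measurable fun p : (Fin t → Round 𝓗 S A H) × 𝓗 => (p.1 s, p.2) := by fun_prop
  have h2 := (measurable_compensatedRatio truth cls ρ πexp).comp h1
  exact h2

lemma lintegral_lintegral_prod_compensatedRatio_le_one (η : ℝ)
    (hV : Measurable fun f => optValue (cls.model f) ρ) (t : ℕ) :
    ∫⁻ hist, ∫⁻ f, ∏ s, compensatedRatio truth cls ρ πexp f (hist s) ∂p₀
      ∂(runLaw truth cls ρ πexp γ η p₀ t) ≤ 1 := by
  have := isFiniteMeasure_runLaw truth cls ρ πexp γ η p₀ hV t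
  rw [lintegral_lintegral_swap (measurable_prod_compensatedRatio truth cls ρ πexp t).aemeasurable]
  calc _ ≤ ∫⁻ _, 1 ∂p₀ := lintegral_mono fun f =>
        lintegral_prod_compensatedRatio_le_one truth cls ρ πexp γ η p₀ hV f t
    _ = 1 := by simp

lemma ae_lintegral_relWeight_ne_top (η : ℝ)
    (hV : Measurable fun f => optValue (cls.model f) ρ) (t : ℕ) :
    ∀ᵐ hist ∂(runLaw truth cls ρ πexp γ η p₀ t), ∫⁻ f, relWeight truth cls ρ γ hist f ∂p₀ ≠ ∞ := by
  have hfin : ∫⁻ hist, ∫⁻ f, ∏ s, compensatedRatio truth cls ρ πexp f (hist s) ∂p₀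
      ∂(runLaw truth cls ρ πexp γ η p₀ t) ≠ ∞ :=
    ((lintegral_lintegral_prod_compensatedRatio_le_one truth cls ρ πexp γ p₀ η hV t).trans_lt
      ENNReal.one_lt_top).ne
  have hm := (measurable_prod_compensatedRatio truth cls ρ πexp t)
  filter_upwards [ae_lt_top hm.lintegral_prod_right' hfin] with hist hh
  refine ((lintegral_mono fun f => relWeight_le truth cls ρ πexp γ hist f).trans_lt ?_).ne
  rw [lintegral_const_mul' _ _ ENNReal.ofReal_ne_top]
  exact ENNReal.mul_lt_top ENNReal.ofReal_lt_top hh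

variable {truth cls ρ πexp γ p₀} {η : ℝ}

/-- What holds almost surely for the step laws holds almost surely along a run. -/
lemma ae_runLaw_of_ae_stepKernel (hV : Measurable fun f => optValue (cls.model f) ρ) (t : ℕ)
    (hn : ∀ u < t, Normalizes truth cls ρ πexp γ η p₀ u) {h : Fin H} {p : (S × A) × S → Prop}
    (hp : MeasurableSet {w | p w}) (hae : ∀ g, ∀ᵐ w ∂(stepKernel truth ρ πexp h g), p w)
    (s : Fin t) : ∀ᵐ run ∂(runLaw truth cls ρ πexp γ η p₀ t), p ((run s).2 h) := by
  obtain ⟨mix, _, heq⟩ := exists_map_runLaw_eq_comp hV t hn s h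
  have hm : Measurable fun run : Fin t → Round 𝓗 S A H => (run s).2 h := by fun_prop
  rw [← ae_map_iff hm.aemeasurable hp, heq]
  exact Measure.ae_comp_of_ae_ae hp (.of_forall hae)

lemma ae_stepKernel_dens_ne_zero (h : Fin H) (g : 𝓗) :
    ∀ᵐ w ∂(stepKernel truth ρ πexp h g), truth.dens h w.1.1 w.1.2 w.2 ≠ 0 := by
  have hms : MeasurableSet {w : (S × A) × S | truth.dens h w.1.1 w.1.2 w.2 ≠ 0} :=
    (truth.measurable_dens h) (measurableSet_singleton 0).compl
  rw [stepKernel_apply, Measure.ae_compProd_iff hms]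
  refine .of_forall fun z => ?_
  rw [truth.transKernel_apply, MDP.transLaw,
    ae_withDensity_iff (truth.measurable_dens_apply h z.1 z.2).coe_nnreal_ennreal]
  exact .of_forall fun y hy => by simpa using hy

lemma ae_stepKernel_model_dens_ne_zero {ε : ℝ} {f : 𝓗} (hf : f ∈ nearTruth truth cls ρ ε)
    (h : Fin H) (g : 𝓗) :
    ∀ᵐ w ∂(stepKernel truth ρ πexp h g), (cls.model f).dens h w.1.1 w.1.2 w.2 ≠ 0 := by
  have hms : MeasurableSet {w : (S × A) × S | (cls.model f).dens h w.1.1 w.1.2 w.2 ≠ 0} :=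
    ((cls.model f).measurable_dens h) (measurableSet_singleton 0).compl
  rw [stepKernel_apply, Measure.ae_compProd_iff hms]
  refine .of_forall fun z => ?_
  rw [truth.transKernel_apply]
  -- Finite KL divergence forces absolute continuity, so the model density can vanish only on a null
  -- set of the true transition.
  have hac : truth.transLaw h z ≪ (cls.model f).transLaw h z :=
    (InformationTheory.klDiv_ne_top_iff.1
      ((hf.2 h z).trans_lt ENNReal.ofReal_lt_top).ne).1
  refine hac ?_
  change ∀ᵐ y ∂((cls.model f).transLaw h z), (cls.model f).dens h z.1 z.2 y ≠ 0
  rw [MDP.transLaw, ae_withDensity_iff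
    ((cls.model f).measurable_dens_apply h z.1 z.2).coe_nnreal_ennreal]
  exact .of_forall fun y hy => by simpa using hy

lemma ae_dens_ne_zero (hV : Measurable fun f => optValue (cls.model f) ρ) (t : ℕ)
    (hn : ∀ u < t, Normalizes truth cls ρ πexp γ η p₀ u) :
    ∀ᵐ hist ∂(runLaw truth cls ρ πexp γ η p₀ t), ∀ s h,
      truth.dens h ((hist s).2 h).1.1 ((hist s).2 h).1.2 ((hist s).2 h).2 ≠ 0 :=
  ae_all_iff.2 fun s => ae_all_iff.2 fun h => ae_runLaw_of_ae_stepKernel hV t hn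
    (p := fun w => truth.dens h w.1.1 w.1.2 w.2 ≠ 0)
    ((truth.measurable_dens h) (measurableSet_singleton 0).compl)
    (ae_stepKernel_dens_ne_zero h) s

lemma ae_ratio_pos (hV : Measurable fun f => optValue (cls.model f) ρ) (t : ℕ)
    (hn : ∀ u < t, Normalizes truth cls ρ πexp γ η p₀ u) {ε : ℝ} {f : 𝓗}
    (hf : f ∈ nearTruth truth cls ρ ε) :
    ∀ᵐ hist ∂(runLaw truth cls ρ πexp γ η p₀ t), ∀ s h, 0 < ratio truth cls h f ((hist s).2 h) := by
  refine ae_all_iff.2 fun s => ae_all_iff.2 fun h => ae_runLaw_of_ae_stepKernel hV t hn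
    (p := fun w => 0 < ratio truth cls h f w)
    ((measurable_ratio_apply truth cls h f) measurableSet_Ioi) (fun g => ?_) s
  filter_upwards [ae_stepKernel_dens_ne_zero (truth := truth) (πexp := πexp) h g,
    ae_stepKernel_model_dens_ne_zero (πexp := πexp) hf h g] with w h1 h2
  exact pos_iff_ne_zero.2 (div_ne_zero h2 h1)

/-- The set `nearTruth` involves a supremum over all (x, a) and is not assumed measurable.
Measurability of the property is used instead, obtained from the measures of the sections of a
measurable set. -/
lemma ae_restrict_ae_ratio_pos (hV : Measurable fun f => optValue (cls.model f) ρ) (t : ℕ)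
    (hn : ∀ u < t, Normalizes truth cls ρ πexp γ η p₀ u) (ε : ℝ) :
    ∀ᵐ f ∂(p₀.restrict (nearTruth truth cls ρ ε)), ∀ᵐ hist ∂(runLaw truth cls ρ πexp γ η p₀ t),
      ∀ s h, 0 < ratio truth cls h f ((hist s).2 h) := by
  have := isFiniteMeasure_runLaw truth cls ρ πexp γ η p₀ hV t
  rw [ae_restrict_iff]
  · exact .of_forall fun f hf => ae_ratio_pos hV t hn hf
  · have h3 := (measurable_measure_prodMk_left (ν := runLaw truth cls ρ πexp γ η p₀ t)
      (measurableSet_ratio_pos truth cls t).compl) (measurableSet_singleton 0)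
    exact h3

lemma ae_ae_restrict_ratio_pos (hV : Measurable fun f => optValue (cls.model f) ρ) (t : ℕ)
    (hn : ∀ u < t, Normalizes truth cls ρ πexp γ η p₀ u) (ε : ℝ) :
    ∀ᵐ hist ∂(runLaw truth cls ρ πexp γ η p₀ t), ∀ᵐ f ∂(p₀.restrict (nearTruth truth cls ρ ε)),
      ∀ s h, 0 < ratio truth cls h f ((hist s).2 h) := by
  have := isFiniteMeasure_runLaw truth cls ρ πexp γ η p₀ hV t
  have h2 := ae_restrict_ae_ratio_pos hV t hn ε
  rwa [Measure.ae_ae_comm (measurableSet_ratio_pos truth cls t)] at h2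

/-- A vanishing normalizer would make `relWeight` zero almost everywhere on 𝓗(ε), where it is almost
everywhere positive, although 𝓗(ε) has positive prior mass. -/
lemma ae_lintegral_relWeight_ne_zero (hV : Measurable fun f => optValue (cls.model f) ρ) (t : ℕ)
    (hn : ∀ u < t, Normalizes truth cls ρ πexp γ η p₀ u) {ε : ℝ}
    (hε : p₀ (nearTruth truth cls ρ ε) ≠ 0) :
    ∀ᵐ hist ∂(runLaw truth cls ρ πexp γ η p₀ t), ∫⁻ f, relWeight truth cls ρ γ hist f ∂p₀ ≠ 0 := by
  filter_upwards [ae_ae_restrict_ratio_pos hV t hn ε] with hist hh h0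
  rw [lintegral_eq_zero_iff (measurable_relWeight_apply truth cls ρ γ hV hist)] at h0
  have h1 : ∀ᵐ f ∂(p₀.restrict (nearTruth truth cls ρ ε)), False := by
    filter_upwards [hh, ae_restrict_of_ae h0] with f hf hf0
    refine absurd hf0 (mul_ne_zero (by simp [Real.exp_pos]) ?_)
    exact Finset.prod_ne_zero_iff.2 fun s _ => Finset.prod_ne_zero_iff.2 fun h _ => by
      simpa using (hf s h).ne'
  simp only [Filter.eventually_false_iff_eq_bot, ae_eq_bot, Measure.restrict_eq_zero] at h1
  exact hε h1

/-- Almost surely, the posterior has density `relWeight` up to normalization. -/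
lemma ae_posterior_eq (hV : Measurable fun f => optValue (cls.model f) ρ) (t : ℕ)
    (hn : ∀ u < t, Normalizes truth cls ρ πexp γ (1 / 2) p₀ u) :
    ∀ᵐ hist ∂(runLaw truth cls ρ πexp γ (1 / 2) p₀ t), posterior cls ρ γ (1 / 2) p₀ hist =
      p₀.withDensity fun f => relWeight truth cls ρ γ hist f /
        ∫⁻ g, relWeight truth cls ρ γ hist g ∂p₀ := by
  filter_upwards [ae_dens_ne_zero hV t hn] with hist hh
  rw [posterior]
  congr 1
  funext f
  simp_rw [weight_eq_refWeight_mul_relWeight truth cls ρ γ hh]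
  rw [lintegral_const_mul' _ _ (refWeight_ne_top truth ρ γ hist),
    ENNReal.mul_div_mul_left _ _ (refWeight_ne_zero truth ρ γ hh) (refWeight_ne_top truth ρ γ hist)]

lemma normalizes (hV : Measurable fun f => optValue (cls.model f) ρ) {ε : ℝ}
    (hε : p₀ (nearTruth truth cls ρ ε) ≠ 0) (t : ℕ) :
    Normalizes truth cls ρ πexp γ (1 / 2) p₀ t := by
  induction t using Nat.strong_induction_on with
  -- Normalization in earlier rounds makes the true densities of the observed data almost surely
  -- nonzero, which the relative form of the current posterior requires.
  | h t hn =>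
    filter_upwards [ae_posterior_eq hV t hn, ae_lintegral_relWeight_ne_zero hV t hn hε,
      ae_lintegral_relWeight_ne_top truth cls ρ πexp γ p₀ (1 / 2) hV t] with hist h1 h2 h3
    rw [h1, withDensity_apply _ MeasurableSet.univ, setLIntegral_univ]
    simp_rw [div_eq_mul_inv]
    rw [lintegral_mul_const _ (measurable_relWeight_apply truth cls ρ γ hV hist), ENNReal.mul_inv_cancel h2 h3]

end ModelBasedMDP
end

/-! ### First moments of log-likelihood ratios from KL bounds -/

noncomputable section
namespace ModelBasedMDP

section Auxiliary

variable {α β : Type*} [MeasurableSpace α] [MeasurableSpace β]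

/-- The first absolute moment of `ψ` is at most `B`, and its mean is at most `C`. -/
structure MeanBound (μ : Measure α) (ψ : α → ℝ) (B : ℝ≥0∞) (C : ℝ) : Prop where
  lintegral_le : ∫⁻ x, ‖ψ x‖ₑ ∂μ ≤ B
  integral_le : ∫ x, ψ x ∂μ ≤ C

lemma MeanBound.integrable {μ : Measure α} {ψ : α → ℝ} {B : ℝ≥0∞} {C : ℝ}
    (h : MeanBound μ ψ B C) (hψ : Measurable ψ) (hB : B ≠ ∞) : Integrable ψ μ :=
  ⟨hψ.aestronglyMeasurable, h.lintegral_le.trans_lt hB.lt_top⟩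

/-- A bound on means alone would not survive mixing. The uniform absolute moment gives integrability
on the product, which Fubini needs before the means can be averaged. -/
lemma MeanBound.compProd {μ : Measure α} [IsProbabilityMeasure μ] {κ : Kernel α β}
    [IsSFiniteKernel κ] {ψ : α × β → ℝ} (hψ : Measurable ψ) {B : ℝ≥0∞} (hB : B ≠ ∞) {C : ℝ}
    (h : ∀ᵐ a ∂μ, MeanBound (κ a) (fun b => ψ (a, b)) B C) : MeanBound (μ ⊗ₘ κ) ψ B C := by
  have h1 : ∫⁻ x, ‖ψ x‖ₑ ∂(μ ⊗ₘ κ) ≤ B := by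
    rw [Measure.lintegral_compProd hψ.enorm]
    calc _ ≤ ∫⁻ _, B ∂μ := lintegral_mono_ae (h.mono fun a ha => ha.lintegral_le)
      _ = B := by simp
  have h2 : Integrable ψ (μ ⊗ₘ κ) := ⟨hψ.aestronglyMeasurable, h1.trans_lt hB.lt_top⟩
  refine ⟨h1, ?_⟩
  rw [Measure.integral_compProd h2]
  calc _ ≤ ∫ _, C ∂μ := integral_mono_ae (Integrable.integral_compProd h2) (integrable_const C)
        (h.mono fun a ha => ha.integral_le)
    _ = C := by simp

lemma MeanBound.of_map {μ : Measure α} {g : α → β} (hg : Measurable g) {ψ : β → ℝ}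
    (hψ : Measurable ψ) {B : ℝ≥0∞} {C : ℝ} (h : MeanBound (μ.map g) ψ B C) :
    MeanBound μ (fun x => ψ (g x)) B C := by
  obtain ⟨h1, h2⟩ := h
  rw [lintegral_map hψ.enorm hg] at h1
  rw [integral_map hg.aemeasurable hψ.aestronglyMeasurable] at h2
  exact ⟨h1, h2⟩

lemma MeanBound.map {μ : Measure α} {g : α → β} (hg : Measurable g) {ψ : β → ℝ}
    (hψ : Measurable ψ) {B : ℝ≥0∞} {C : ℝ} (h : MeanBound μ (fun x => ψ (g x)) B C) :
    MeanBound (μ.map g) ψ B C := by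
  obtain ⟨h1, h2⟩ := h
  rw [← lintegral_map hψ.enorm hg] at h1
  rw [← integral_map hg.aemeasurable hψ.aestronglyMeasurable] at h2
  exact ⟨h1, h2⟩

lemma MeanBound.comp {μ : Measure α} [IsProbabilityMeasure μ] {κ : Kernel α β}
    [IsSFiniteKernel κ] {ψ : β → ℝ} (hψ : Measurable ψ) {B : ℝ≥0∞} (hB : B ≠ ∞) {C : ℝ}
    (h : ∀ a, MeanBound (κ a) ψ B C) : MeanBound (κ ∘ₘ μ) ψ B C := by
  rw [← Measure.snd_compProd]
  exact MeanBound.map measurable_snd hψ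
    (MeanBound.compProd (hψ.comp measurable_snd) hB (.of_forall h))

/-- The posterior kernel is only almost surely of mass one, so the marginal formula for Markov
kernels is replaced by this almost-sure version. -/
lemma fst_compProd_of_ae {μ : Measure α} [SFinite μ] {κ : Kernel α β} [IsSFiniteKernel κ]
    (h : ∀ᵐ a ∂μ, κ a Set.univ = 1) : (μ ⊗ₘ κ).map Prod.fst = μ := by
  ext s hs
  rw [Measure.map_apply measurable_fst hs, ← lintegral_indicator_one (measurable_fst hs),
    Measure.lintegral_compProd (measurable_one.indicator (measurable_fst hs)),
    ← lintegral_indicator_one hs]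
  refine lintegral_congr_ae (h.mono fun a ha => ?_)
  change ∫⁻ _, s.indicator 1 a ∂(κ a) = _
  rw [lintegral_const, ha, mul_one]

end Auxiliary

section Density

variable {S : Type*} [MeasurableSpace S] {ν : Measure S} {p q : S → ℝ≥0}

/-- Division by 0 is harmless here: absolute continuity makes q vanish ν-almost everywhere on the
zero set of p. -/
lemma withDensity_eq_withDensity_div (hp : Measurable p) (hq : Measurable q)
    (hac : ν.withDensity (fun y => (q y : ℝ≥0∞)) ≪ ν.withDensity fun y => (p y : ℝ≥0∞)) :
    ν.withDensity (fun y => (q y : ℝ≥0∞)) =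
      (ν.withDensity fun y => (p y : ℝ≥0∞)).withDensity fun y => ((q y / p y : ℝ≥0) : ℝ≥0∞) := by
  have hm : Measurable fun y => ((q y / p y : ℝ≥0) : ℝ≥0∞) := (hq.div hp).coe_nnreal_ennreal
  rw [← withDensity_mul _ hp.coe_nnreal_ennreal hm]
  refine withDensity_congr_ae ?_
  have h1 : ∀ᵐ y ∂(ν.withDensity fun y => (p y : ℝ≥0∞)), p y ≠ 0 := by
    rw [ae_withDensity_iff hp.coe_nnreal_ennreal]
    exact .of_forall fun y hy => by simpa using hy
  have h2 := hac h1
  change ∀ᵐ y ∂(ν.withDensity fun y => (q y : ℝ≥0∞)), p y ≠ 0 at h2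
  rw [ae_withDensity_iff hq.coe_nnreal_ennreal] at h2
  filter_upwards [h2] with y hy
  rw [Pi.mul_apply, ← ENNReal.coe_mul]
  by_cases h : p y = 0
  · have : q y = 0 := by
      by_contra hq0
      exact hy (by simpa using hq0) h
    simp [this]
  · rw [mul_div_cancel₀ _ h]

lemma llr_withDensity [SigmaFinite ν] (hp : Measurable p) (hq : Measurable q)
    (hac : ν.withDensity (fun y => (q y : ℝ≥0∞)) ≪ ν.withDensity fun y => (p y : ℝ≥0∞)) :
    llr (ν.withDensity fun y => (q y : ℝ≥0∞)) (ν.withDensity fun y => (p y : ℝ≥0∞))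
      =ᵐ[ν.withDensity fun y => (q y : ℝ≥0∞)] fun y => -Real.log (p y / q y : ℝ≥0) := by
  have h := Measure.rnDeriv_withDensity (ν.withDensity fun y => (p y : ℝ≥0∞))
    (hq.div hp).coe_nnreal_ennreal
  simp only [Pi.div_apply] at h
  rw [← withDensity_eq_withDensity_div hp hq hac] at h
  filter_upwards [hac h] with y hy
  rw [llr, hy, ENNReal.coe_toReal, ← Real.log_inv, ← NNReal.coe_inv, inv_div]

lemma lintegral_div_withDensity_le_one (hp : Measurable p) (hq : Measurable q)
    (hp1 : ∫⁻ y, (p y : ℝ≥0∞) ∂ν = 1) :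
    ∫⁻ y, ((p y / q y : ℝ≥0) : ℝ≥0∞) ∂(ν.withDensity fun y => (q y : ℝ≥0∞)) ≤ 1 := by
  have hm : Measurable fun y => ((p y / q y : ℝ≥0) : ℝ≥0∞) := (hp.div hq).coe_nnreal_ennreal
  rw [lintegral_withDensity_eq_lintegral_mul _ hq.coe_nnreal_ennreal hm, ← hp1]
  refine lintegral_mono fun y => ?_
  rw [Pi.mul_apply, ← ENNReal.coe_mul, ENNReal.coe_le_coe]
  by_cases h : q y = 0
  · simp [h]
  · rw [mul_div_cancel₀ _ h]

/-- A bound on the Kullback-Leibler divergence bounds the moments of the log-likelihood ratio. -/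
lemma meanBound_neg_log_div [SigmaFinite ν] (hp : Measurable p) (hq : Measurable q)
    (hp1 : ∫⁻ y, (p y : ℝ≥0∞) ∂ν = 1) (hq1 : ∫⁻ y, (q y : ℝ≥0∞) ∂ν = 1) {ε : ℝ} (hε : 0 ≤ ε)
    (hkl : InformationTheory.klDiv (ν.withDensity fun y => (q y : ℝ≥0∞))
      (ν.withDensity fun y => (p y : ℝ≥0∞)) ≤ ENNReal.ofReal ε) :
    MeanBound (ν.withDensity fun y => (q y : ℝ≥0∞)) (fun y => -Real.log (p y / q y : ℝ≥0))
      (ENNReal.ofReal (ε + 2)) ε := by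
  have hP : IsProbabilityMeasure (ν.withDensity fun y => (p y : ℝ≥0∞)) :=
    ⟨by rw [withDensity_apply _ MeasurableSet.univ, setLIntegral_univ, hp1]⟩
  have hQ : IsProbabilityMeasure (ν.withDensity fun y => (q y : ℝ≥0∞)) :=
    ⟨by rw [withDensity_apply _ MeasurableSet.univ, setLIntegral_univ, hq1]⟩
  have hne := (hkl.trans_lt ENNReal.ofReal_lt_top).ne
  obtain ⟨hac, hint⟩ := InformationTheory.klDiv_ne_top_iff.1 hne
  have hllr := llr_withDensity hp hq hac
  rw [integrable_congr hllr] at hint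
  have hmean : ∫ y, -Real.log (p y / q y : ℝ≥0) ∂(ν.withDensity fun y => (q y : ℝ≥0∞)) ≤ ε := by
    rw [← integral_congr_ae hllr,
      ← InformationTheory.toReal_klDiv_of_measure_eq hac (by simp)]
    exact ENNReal.toReal_le_of_le_ofReal hε hkl
  have hr1 := lintegral_div_withDensity_le_one hp hq hp1
  have hrm : Measurable fun y => ((p y / q y : ℝ≥0) : ℝ) := (hp.div hq).coe_nnreal_real
  have hri : Integrable (fun y => ((p y / q y : ℝ≥0) : ℝ))
      (ν.withDensity fun y => (q y : ℝ≥0∞)) :=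
    ⟨hrm.aestronglyMeasurable, by
      rw [hasFiniteIntegral_iff_ofReal (.of_forall fun y => NNReal.coe_nonneg _)]
      simpa only [ENNReal.ofReal_coe_nnreal] using hr1.trans_lt ENNReal.one_lt_top⟩
  have hri1 : ∫ y, ((p y / q y : ℝ≥0) : ℝ) ∂(ν.withDensity fun y => (q y : ℝ≥0∞)) ≤ 1 := by
    rw [integral_eq_lintegral_of_nonneg_ae (.of_forall fun y => NNReal.coe_nonneg _)
      hrm.aestronglyMeasurable]
    simp only [ENNReal.ofReal_coe_nnreal]
    exact ENNReal.toReal_le_of_le_ofReal zero_le_one (by simpa using hr1)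
  refine ⟨?_, hmean⟩
  rw [← ofReal_integral_norm_eq_lintegral_enorm hint]
  refine ENNReal.ofReal_le_ofReal ?_
  -- Since log r ≤ r for r ≥ 0, |log r| ≤ -log r + 2r; the mean of the ratio is at most 1, whence
  -- the constant ε + 2.
  calc _ ≤ ∫ y, (-Real.log (p y / q y : ℝ≥0) + 2 * ((p y / q y : ℝ≥0) : ℝ))
        ∂(ν.withDensity fun y => (q y : ℝ≥0∞)) := by
        refine integral_mono hint.norm (hint.add (hri.const_mul 2)) fun y => ?_
        have h0 := NNReal.coe_nonneg (p y / q y)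
        have h1 := Real.log_le_self h0
        change |-Real.log (p y / q y : ℝ≥0)| ≤ _
        rw [abs_le]
        constructor <;> linarith
    _ ≤ ε + 2 := by
        rw [integral_add hint (hri.const_mul 2), integral_const_mul]
        linarith

end Density

variable {𝓗 S A : Type*} [MeasurableSpace 𝓗] [MeasurableSpace S] [MeasurableSpace A]
  {H : ℕ} {ν : Measure S} [SigmaFinite ν] {truth : MDP S A H ν} {cls : ModelClass 𝓗 S A H ν}
  {ρ : Measure S} [IsProbabilityMeasure ρ] {πexp : Fin H → PolicyFamily 𝓗 S A H} {γ η : ℝ}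
  {p₀ : Measure 𝓗} [IsProbabilityMeasure p₀]

/-- The KL bound in 𝓗(ε) is uniform in (x, a), so the estimate does not depend on the policy that
produced the pair. It therefore passes to any mixture of step laws, in particular to the run. -/
lemma meanBound_stepKernel {ε : ℝ} (hε : 0 ≤ ε) {f : 𝓗} (hf : f ∈ nearTruth truth cls ρ ε)
    (h : Fin H) (g : 𝓗) :
    MeanBound (stepKernel truth ρ πexp h g) (fun w => -Real.log (ratio truth cls h f w))
      (ENNReal.ofReal (ε + 2)) ε := by
  rw [stepKernel_apply]
  refine MeanBound.compProd
    ((Real.measurable_log.comp (measurable_ratio_apply truth cls h f).coe_nnreal_real).neg)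
    ENNReal.ofReal_ne_top (.of_forall fun z => ?_)
  rw [truth.transKernel_apply]
  exact meanBound_neg_log_div (MDP.measurable_dens_apply _ _ _ _)
    (MDP.measurable_dens_apply _ _ _ _) (MDP.lintegral_dens _ _ _ _) (MDP.lintegral_dens _ _ _ _)
    hε (hf.2 h z)

lemma meanBound_runLaw (hV : Measurable fun f => optValue (cls.model f) ρ) (t : ℕ)
    (hn : ∀ u < t, Normalizes truth cls ρ πexp γ η p₀ u) {ε : ℝ} (hε : 0 ≤ ε) {f : 𝓗}
    (hf : f ∈ nearTruth truth cls ρ ε) (s : Fin t) (h : Fin H) :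
    MeanBound (runLaw truth cls ρ πexp γ η p₀ t)
      (fun hist => -Real.log (ratio truth cls h f ((hist s).2 h))) (ENNReal.ofReal (ε + 2)) ε := by
  have hm : Measurable fun w => -Real.log (ratio truth cls h f w) :=
    (Real.measurable_log.comp (measurable_ratio_apply truth cls h f).coe_nnreal_real).neg
  obtain ⟨mix, _, heq⟩ := exists_map_runLaw_eq_comp hV t hn s h
  have hm' : Measurable fun run : Fin t → Round 𝓗 S A H => (run s).2 h := by fun_prop
  refine MeanBound.of_map hm' hm ?_
  rw [heq]
  exact MeanBound.comp hm ENNReal.ofReal_ne_top fun g => meanBound_stepKernel hε hf h g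

end ModelBasedMDP
end

/-! ### The potential of the posterior sample and its expected size -/

noncomputable section
namespace ModelBasedMDP

section Auxiliary

variable {α : Type*} [MeasurableSpace α]

lemma ae_cond_of_ae_restrict {μ : Measure α} {s : Set α} {P : α → Prop}
    (h : ∀ᵐ x ∂(μ.restrict s), P x) : ∀ᵐ x ∂μ[|s], P x :=
  Measure.ae_smul_measure h _

/-- The conditioning set may be nonmeasurable; measurability is asked of the property instead,
because the set will be `nearTruth`. -/
lemma ae_cond_of_forall_mem_of_measurableSet {μ : Measure α} {s : Set α} {P : α → Prop}
    (hP : MeasurableSet {x | P x}) (h : ∀ x ∈ s, P x) : ∀ᵐ x ∂μ[|s], P x :=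
  ae_cond_of_ae_restrict ((ae_restrict_iff hP).2 (.of_forall h))

end Auxiliary

variable {𝓗 S A : Type*} [MeasurableSpace 𝓗] [MeasurableSpace S] [MeasurableSpace A]
  {H : ℕ} {ν : Measure S} (truth : MDP S A H ν) (cls : ModelClass 𝓗 S A H ν)
  (ρ : Measure S) (πexp : Fin H → PolicyFamily 𝓗 S A H) (γ : ℝ)

/-- The scaled optimism gap of a hypothesis plus its discrepancies along the history. -/
def potential {t : ℕ} (hist : Fin t → Round 𝓗 S A H) (f : 𝓗) : ℝ :=
  γ * (optValue truth ρ - optValue (cls.model f) ρ) +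
    ∑ s, roundDiscrepancy truth cls ρ πexp (hist s) f

/-- The potential is chosen for this identity: its value part cancels the optimism factor, and its
discrepancy part supplies the compensators. -/
lemma relWeight_mul_exp_potential {t : ℕ} (hist : Fin t → Round 𝓗 S A H) (f : 𝓗) :
    relWeight truth cls ρ γ hist f *
      ENNReal.ofReal (Real.exp (potential truth cls ρ πexp γ hist f)) =
      ∏ s, compensatedRatio truth cls ρ πexp f (hist s) := by
  simp_rw [compensatedRatio]
  rw [Finset.prod_mul_distrib, ← ENNReal.ofReal_prod_of_nonneg fun i _ => (Real.exp_pos _).le,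
    ← Real.exp_sum, relWeight, mul_right_comm, ← ENNReal.ofReal_mul (Real.exp_pos _).le,
    ← Real.exp_add, potential]
  congr 4
  ring

variable [SigmaFinite ν] [IsProbabilityMeasure ρ]

lemma measurable_potential (hV : Measurable fun f => optValue (cls.model f) ρ) (t : ℕ) :
    Measurable fun q : (Fin t → Round 𝓗 S A H) × 𝓗 =>
      potential truth cls ρ πexp γ q.1 q.2 := by
  refine Measurable.add (((hV.comp measurable_snd).const_sub _).const_mul γ) ?_
  refine Finset.measurable_fun_sum _ fun s _ => ?_
  have h1 : Measurable fun p : (Fin t → Round 𝓗 S A H) × 𝓗 => (p.1 s, p.2) := by fun_prop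
  have h2 := (measurable_roundDiscrepancy truth cls ρ πexp).comp h1
  exact h2

lemma abs_potential_le {t : ℕ} (hist : Fin t → Round 𝓗 S A H) (f : 𝓗) :
    |potential truth cls ρ πexp γ hist f| ≤ |γ| + t * H := by
  refine (abs_add_le _ _).trans (add_le_add ?_ ?_)
  · rw [abs_mul]
    exact mul_le_of_le_one_right (abs_nonneg _) (abs_optValue_sub_le_one ρ _ _)
  · rw [abs_of_nonneg (Finset.sum_nonneg fun s _ =>
      roundDiscrepancy_nonneg truth cls ρ πexp _ _)]
    exact (Finset.sum_le_sum fun s _ =>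
      roundDiscrepancy_le truth cls ρ πexp (hist s) f).trans (by simp)

lemma integrable_potential (hV : Measurable fun f => optValue (cls.model f) ρ) (t : ℕ)
    (Q : Measure ((Fin t → Round 𝓗 S A H) × 𝓗)) [IsFiniteMeasure Q] :
    Integrable (fun q => potential truth cls ρ πexp γ q.1 q.2) Q :=
  .of_bound (measurable_potential truth cls ρ πexp γ hV t).aestronglyMeasurable (|γ| + t * H)
    (.of_forall fun q => abs_potential_le truth cls ρ πexp γ q.1 q.2)

variable (p₀ : Measure 𝓗) [IsProbabilityMeasure p₀]

/-- The posterior density is `relWeight` / Z, so the factor Z removes the normalization and leaves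
the prior integral of the compensated ratios. Fubini then permits f to be fixed before the run is
integrated. -/
lemma lintegral_exp_potential_mul_le_one (hV : Measurable fun f => optValue (cls.model f) ρ)
    (t : ℕ) (hn : ∀ u < t, Normalizes truth cls ρ πexp γ (1 / 2) p₀ u) :
    ∫⁻ q, ENNReal.ofReal (Real.exp (potential truth cls ρ πexp γ q.1 q.2)) *
        ∫⁻ f, relWeight truth cls ρ γ q.1 f ∂p₀
      ∂(runLaw truth cls ρ πexp γ (1 / 2) p₀ t ⊗ₘ posteriorKernel cls ρ γ (1 / 2) p₀ hV t) ≤ 1 := by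
  have := isFiniteMeasure_runLaw truth cls ρ πexp γ (1 / 2) p₀ hV t
  have hm := (Real.measurable_exp.comp (measurable_potential truth cls ρ πexp γ hV t)).ennreal_ofReal
  have hm' := (measurable_relWeight truth cls ρ γ hV t).lintegral_prod_right' (ν := p₀)
  have hm'' := hm.mul (hm'.comp measurable_fst)
  rw [Measure.lintegral_compProd (by exact hm'')]
  refine (lintegral_mono_ae ?_).trans
    (lintegral_lintegral_prod_compensatedRatio_le_one truth cls ρ πexp γ p₀ (1 / 2) hV t)
  filter_upwards [ae_posterior_eq hV t hn] with hist hh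
  have h1 : Measurable fun f =>
      ENNReal.ofReal (Real.exp (potential truth cls ρ πexp γ hist f)) :=
    Measurable.of_uncurry_left (f := fun (hist : Fin t → Round 𝓗 S A H) f =>
      ENNReal.ofReal (Real.exp (potential truth cls ρ πexp γ hist f))) hm
  have h2 := measurable_relWeight_apply truth cls ρ γ hV hist
  rw [posteriorKernel_apply, lintegral_mul_const _ h1, hh,
    lintegral_withDensity_eq_lintegral_mul _ (h2.div_const _) h1]
  simp_rw [Pi.mul_apply, div_eq_mul_inv, mul_right_comm _ _ (ENNReal.ofReal _),
    relWeight_mul_exp_potential]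
  have h3 : Measurable fun f => ∏ s, compensatedRatio truth cls ρ πexp f (hist s) :=
    Measurable.of_uncurry_left (f := fun (hist : Fin t → Round 𝓗 S A H) f =>
      ∏ s, compensatedRatio truth cls ρ πexp f (hist s))
      (measurable_prod_compensatedRatio truth cls ρ πexp t)
  rw [lintegral_mul_const _ h3, mul_assoc]
  exact mul_le_of_le_one_right zero_le (ENNReal.inv_mul_le_one _)

variable {truth cls ρ πexp γ p₀}

lemma map_fst_compProd_posteriorKernel (hV : Measurable fun f => optValue (cls.model f) ρ)
    {t : ℕ} (hn : Normalizes truth cls ρ πexp γ (1 / 2) p₀ t) :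
    (runLaw truth cls ρ πexp γ (1 / 2) p₀ t ⊗ₘ posteriorKernel cls ρ γ (1 / 2) p₀ hV t).map
      Prod.fst = runLaw truth cls ρ πexp γ (1 / 2) p₀ t := by
  have := isFiniteMeasure_runLaw truth cls ρ πexp γ (1 / 2) p₀ hV t
  exact fst_compProd_of_ae hn

/-- Needed to transfer the mean bound from all members of `nearTruth` to almost every draw from the
conditioned prior. -/
lemma measurableSet_meanBound {α β : Type*} [MeasurableSpace α] [MeasurableSpace β]
    (Q : Measure β) [SFinite Q] {ψ : α × β → ℝ} (hψ : Measurable ψ) (B : ℝ≥0∞) (C : ℝ) :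
    MeasurableSet {a | MeanBound Q (fun b => ψ (a, b)) B C} := by
  have h1 : {a | MeanBound Q (fun b => ψ (a, b)) B C} =
      {a | ∫⁻ b, ‖ψ (a, b)‖ₑ ∂Q ≤ B} ∩ {a | ∫ b, ψ (a, b) ∂Q ≤ C} :=
    Set.ext fun a => ⟨fun h => ⟨h.1, h.2⟩, fun h => ⟨h.1, h.2⟩⟩
  rw [h1]
  exact (measurableSet_le hψ.enorm.lintegral_prod_right' measurable_const).inter
    (measurableSet_le hψ.stronglyMeasurable.integral_prod_right'.measurable measurable_const)

/-- The mean of the negative log-likelihood ratio when the hypothesis is drawn from the prior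
conditioned on the neighbourhood of the truth. -/
lemma meanBound_cond_prod (hV : Measurable fun f => optValue (cls.model f) ρ) (t : ℕ)
    (hn : ∀ u ≤ t, Normalizes truth cls ρ πexp γ (1 / 2) p₀ u) {ε : ℝ} (hε : 0 ≤ ε)
    (hK : p₀ (nearTruth truth cls ρ ε) ≠ 0) (s : Fin t) (h : Fin H) :
    MeanBound (p₀[|nearTruth truth cls ρ ε].prod
      (runLaw truth cls ρ πexp γ (1 / 2) p₀ t ⊗ₘ posteriorKernel cls ρ γ (1 / 2) p₀ hV t))
      (fun p => -Real.log (ratio truth cls h p.1 ((p.2.1 s).2 h))) (ENNReal.ofReal (ε + 2)) ε := by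
  have := isFiniteMeasure_runLaw truth cls ρ πexp γ (1 / 2) p₀ hV t
  have := cond_isProbabilityMeasure hK
  have hr : Measurable fun w : 𝓗 × ((Fin t → Round 𝓗 S A H) × 𝓗) =>
      (w.1, (w.2.1 s).2 h) := by fun_prop
  have hψ : Measurable fun w : 𝓗 × ((Fin t → Round 𝓗 S A H) × 𝓗) =>
      -Real.log (ratio truth cls h w.1 ((w.2.1 s).2 h)) :=
    (Real.measurable_log.comp ((measurable_ratio truth cls h).comp hr).coe_nnreal_real).neg
  rw [← Measure.compProd_const]
  refine MeanBound.compProd hψ ENNReal.ofReal_ne_top ?_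
  simp only [Kernel.const_apply]
  refine ae_cond_of_forall_mem_of_measurableSet (measurableSet_meanBound _ hψ _ _) fun f hf => ?_
  have hb := meanBound_runLaw hV t (fun u hu => hn u hu.le) hε hf s h
  rw [← map_fst_compProd_posteriorKernel hV (hn t le_rfl)] at hb
  have hr' : Measurable fun hist : Fin t → Round 𝓗 S A H => (hist s).2 h := by fun_prop
  exact hb.of_map measurable_fst (Real.measurable_log.comp
    ((measurable_ratio_apply truth cls h f).comp hr').coe_nnreal_real).neg

/-- The exponential moment bound behind the regret analysis. -/
lemma lintegral_cond_prod_le_one (hV : Measurable fun f => optValue (cls.model f) ρ) (t : ℕ)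
    (hn : ∀ u ≤ t, Normalizes truth cls ρ πexp γ (1 / 2) p₀ u) {ε : ℝ}
    (hK : p₀ (nearTruth truth cls ρ ε) ≠ 0) :
    ∫⁻ p, ENNReal.ofReal (Real.exp (potential truth cls ρ πexp γ p.2.1 p.2.2)) *
        (p₀ (nearTruth truth cls ρ ε) * relWeight truth cls ρ γ p.2.1 p.1)
      ∂(p₀[|nearTruth truth cls ρ ε].prod
        (runLaw truth cls ρ πexp γ (1 / 2) p₀ t ⊗ₘ posteriorKernel cls ρ γ (1 / 2) p₀ hV t))
      ≤ 1 := by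
  have := isFiniteMeasure_runLaw truth cls ρ πexp γ (1 / 2) p₀ hV t
  have := cond_isProbabilityMeasure hK
  have h1 : Measurable fun p : 𝓗 × ((Fin t → Round 𝓗 S A H) × 𝓗) =>
      ENNReal.ofReal (Real.exp (potential truth cls ρ πexp γ p.2.1 p.2.2)) :=
    (Real.measurable_exp.comp
      ((measurable_potential truth cls ρ πexp γ hV t).comp measurable_snd)).ennreal_ofReal
  have h2 : Measurable fun p : 𝓗 × ((Fin t → Round 𝓗 S A H) × 𝓗) => (p.2.1, p.1) := by fun_prop
  have h3 := (measurable_relWeight truth cls ρ γ hV t).comp h2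
  have h4 : Measurable fun p : 𝓗 × ((Fin t → Round 𝓗 S A H) × 𝓗) =>
      ENNReal.ofReal (Real.exp (potential truth cls ρ πexp γ p.2.1 p.2.2)) *
        (p₀ (nearTruth truth cls ρ ε) * relWeight truth cls ρ γ p.2.1 p.1) :=
    h1.mul (h3.const_mul _)
  rw [lintegral_prod_symm _ h4.aemeasurable]
  refine (lintegral_mono fun q => ?_).trans
    (lintegral_exp_potential_mul_le_one truth cls ρ πexp γ p₀ hV t fun u hu => hn u hu.le)
  dsimp only
  have h5 := measurable_relWeight_apply truth cls ρ γ hV q.1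
  -- The factor p⁰(𝓗(ε)) cancels the normalization of the conditioned prior, leaving the integral of
  -- `relWeight` over 𝓗(ε), which is at most Z.
  rw [lintegral_const_mul _ (h5.const_mul _), lintegral_const_mul _ h5, ProbabilityTheory.cond,
    lintegral_smul_measure, smul_eq_mul, ← mul_assoc (p₀ _),
    ENNReal.mul_inv_cancel hK (measure_ne_top _ _), one_mul]
  gcongr
  exact Measure.restrict_le_self

/-- The expected potential of the posterior sample is at most the price of covering the truth. -/
theorem integral_potential_le (hV : Measurable fun f => optValue (cls.model f) ρ) (hγ : 0 ≤ γ)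
    (t : ℕ) {ε : ℝ} (hε : 0 ≤ ε) (hK : p₀ (nearTruth truth cls ρ ε) ≠ 0) :
    ∫ q, potential truth cls ρ πexp γ q.1 q.2
      ∂(runLaw truth cls ρ πexp γ (1 / 2) p₀ t ⊗ₘ posteriorKernel cls ρ γ (1 / 2) p₀ hV t)
      ≤ γ * ε + t * H * ε / 2 - Real.log (p₀ (nearTruth truth cls ρ ε)).toReal := by
  have hn : ∀ u, Normalizes truth cls ρ πexp γ (1 / 2) p₀ u := normalizes hV hK
  have := isProbabilityMeasure_runLaw hV t fun u _ => hn u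
  have := cond_isProbabilityMeasure hK
  set c := (p₀ (nearTruth truth cls ρ ε)).toReal with hc
  have hc0 : 0 < c := ENNReal.toReal_pos hK (measure_ne_top _ _)
  set Q := runLaw truth cls ρ πexp γ (1 / 2) p₀ t ⊗ₘ posteriorKernel cls ρ γ (1 / 2) p₀ hV t
    with hQ
  have hfst : Q.map Prod.fst = runLaw truth cls ρ πexp γ (1 / 2) p₀ t :=
    map_fst_compProd_posteriorKernel hV (hn t)
  have hQ1 : IsProbabilityMeasure Q :=
    ⟨by rw [← measure_univ (μ := runLaw truth cls ρ πexp γ (1 / 2) p₀ t), ← hfst,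
      Measure.map_apply measurable_fst MeasurableSet.univ, Set.preimage_univ]⟩
  -- The comparison hypothesis is drawn independently of the history and the posterior sample.
  set M := p₀[|nearTruth truth cls ρ ε].prod Q with hM
  have hℓ (s : Fin t) (h : Fin H) : MeanBound M
      (fun p => -Real.log (ratio truth cls h p.1 ((p.2.1 s).2 h))) (ENNReal.ofReal (ε + 2)) ε :=
    meanBound_cond_prod hV t (fun u _ => hn u) hε hK s h
  have hℓi (s : Fin t) (h : Fin H) : Integrable
      (fun p => -Real.log (ratio truth cls h p.1 ((p.2.1 s).2 h))) M := by
    refine (hℓ s h).integrable ?_ ENNReal.ofReal_ne_top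
    have hr : Measurable fun w : 𝓗 × ((Fin t → Round 𝓗 S A H) × 𝓗) =>
      (w.1, (w.2.1 s).2 h) := by fun_prop
    exact (Real.measurable_log.comp ((measurable_ratio truth cls h).comp hr).coe_nnreal_real).neg
  set L : 𝓗 × ((Fin t → Round 𝓗 S A H) × 𝓗) → ℝ := fun p =>
    ∑ s, ∑ h, -Real.log (ratio truth cls h p.1 ((p.2.1 s).2 h)) with hL
  have hLi : Integrable L M :=
    integrable_finsetSum _ fun s _ => integrable_finsetSum _ fun h _ => hℓi s h
  have hLint : ∫ p, L p ∂M ≤ t * H * ε := by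
    rw [hL, integral_finsetSum _ fun s _ => integrable_finsetSum _ fun h _ => hℓi s h]
    calc _ ≤ ∑ s : Fin t, ∑ h : Fin H, ε := by
          refine Finset.sum_le_sum fun s _ => ?_
          rw [integral_finsetSum _ fun h _ => hℓi s h]
          exact Finset.sum_le_sum fun h _ => (hℓ s h).integral_le
      _ = t * H * ε := by simp [mul_assoc]
  have hGi : Integrable (fun p : 𝓗 × ((Fin t → Round 𝓗 S A H) × 𝓗) =>
      potential truth cls ρ πexp γ p.2.1 p.2.2) M :=
    (integrable_potential truth cls ρ πexp γ hV t Q).comp_snd _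
  have hGint : ∫ p, potential truth cls ρ πexp γ p.2.1 p.2.2 ∂M =
      ∫ q, potential truth cls ρ πexp γ q.1 q.2 ∂Q := by
    rw [hM, integral_fun_snd (fun q : (Fin t → Round 𝓗 S A H) × 𝓗 => potential truth cls ρ πexp γ q.1 q.2)]
    simp
  -- Y is a lower bound for the logarithm of the integrand of `lintegral_cond_prod_le_one`: the
  -- value gap inside `relWeight` is replaced by its worst case ε.
  set Y : 𝓗 × ((Fin t → Round 𝓗 S A H) × 𝓗) → ℝ := fun p =>
    potential truth cls ρ πexp γ p.2.1 p.2.2 + (Real.log c - γ * ε) - 1 / 2 * L p with hY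
  have hYi : Integrable Y M := (hGi.add (integrable_const _)).sub (hLi.const_mul _)
  have hYint : ∫ p, Y p ∂M = ∫ q, potential truth cls ρ πexp γ q.1 q.2 ∂Q
      + (Real.log c - γ * ε) - 1 / 2 * ∫ p, L p ∂M := by
    rw [hY, integral_sub (by exact hGi.add (integrable_const _)) (hLi.const_mul _),
      integral_add hGi (integrable_const _), hGint, integral_const_mul]
    simp
  have hexp : ∀ᵐ p ∂M, ENNReal.ofReal (Real.exp (Y p)) ≤
      ENNReal.ofReal (Real.exp (potential truth cls ρ πexp γ p.2.1 p.2.2)) *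
        (p₀ (nearTruth truth cls ρ ε) * relWeight truth cls ρ γ p.2.1 p.1) := by
    have hpos : ∀ᵐ p ∂M, ∀ s h, 0 < ratio truth cls h p.1 ((p.2.1 s).2 h) := by
      have hr : Measurable fun w : 𝓗 × ((Fin t → Round 𝓗 S A H) × 𝓗) => (w.1, w.2.1) := by
        fun_prop
      rw [hM, ← Measure.compProd_const]
      refine Measure.ae_compProd_of_ae_ae (hr (measurableSet_ratio_pos truth cls t)) ?_
      refine ae_cond_of_ae_restrict
        ((ae_restrict_ae_ratio_pos hV t (fun u _ => hn u) ε).mono fun f hf => ?_)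
      rw [← hfst] at hf
      exact ae_of_ae_map measurable_fst.aemeasurable hf
    have hgap : ∀ᵐ p ∂M, optValue truth ρ - optValue (cls.model p.1) ρ ≤ ε := by
      have hgap' : ∀ᵐ f ∂p₀[|nearTruth truth cls ρ ε],
          optValue truth ρ - optValue (cls.model f) ρ ≤ ε :=
        ae_cond_of_forall_mem_of_measurableSet
          (measurableSet_le (hV.const_sub _) measurable_const) fun f hf => hf.1
      exact Measure.quasiMeasurePreserving_fst.ae hgap'
    filter_upwards [hpos, hgap] with p hp1 hp2
    have hprod : ENNReal.ofReal (Real.exp (-(1 / 2 * L p))) =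
        ∏ s, sqrtRatio truth cls (p.2.1 s) p.1 := by
      have hsum : -(1 / 2 * L p) =
          ∑ s, ∑ h, Real.log (ratio truth cls h p.1 ((p.2.1 s).2 h)) / 2 := by
        simp only [hL, Finset.sum_neg_distrib, mul_neg, neg_neg, Finset.mul_sum]
        exact Finset.sum_congr rfl fun s _ => Finset.sum_congr rfl fun h _ => by ring
      rw [hsum, Real.exp_sum, ENNReal.ofReal_prod_of_nonneg fun i _ => (Real.exp_pos _).le]
      refine Finset.prod_congr rfl fun s _ => ?_
      rw [Real.exp_sum, ENNReal.ofReal_prod_of_nonneg fun i _ => (Real.exp_pos _).le, sqrtRatio]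
      refine Finset.prod_congr rfl fun h _ => ?_
      rw [Real.exp_half, Real.exp_log (by exact_mod_cast hp1 s h), ← Real.coe_sqrt,
        ENNReal.ofReal_coe_nnreal]
    have hsplit : Y p = potential truth cls ρ πexp γ p.2.1 p.2.2 +
        (Real.log c + (-(γ * ε) + -(1 / 2 * L p))) := by simp only [hY]; ring
    rw [hsplit, Real.exp_add, Real.exp_add, Real.exp_add, Real.exp_log hc0,
      ENNReal.ofReal_mul (Real.exp_pos _).le, ENNReal.ofReal_mul hc0.le,
      ENNReal.ofReal_mul (Real.exp_pos _).le, hprod, hc, ENNReal.ofReal_toReal (measure_ne_top _ _),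
      relWeight]
    gcongr
    -- With γ ≥ 0, the gap V* - V_f ≤ ε gives -γε ≤ γ(V_f - V*).
    nlinarith
  have hYm : AEMeasurable (fun p => ENNReal.ofReal (Real.exp (Y p))) M :=
    (Real.measurable_exp.comp_aemeasurable hYi.aemeasurable).ennreal_ofReal
  have hlin : ∫⁻ p, ENNReal.ofReal (Real.exp (Y p)) ∂M ≤ 1 :=
    (lintegral_mono_ae hexp).trans (lintegral_cond_prod_le_one hV t (fun u _ => hn u) hK)
  have hei : Integrable (fun p => Real.exp (Y p)) M :=
    ⟨Real.measurable_exp.comp_aemeasurable hYi.aemeasurable |>.aestronglyMeasurable, by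
      rw [hasFiniteIntegral_iff_ofReal (.of_forall fun p => (Real.exp_pos _).le)]
      exact hlin.trans_lt ENNReal.one_lt_top⟩
  have he1 : ∫ p, Real.exp (Y p) ∂M ≤ 1 := by
    rw [integral_eq_lintegral_of_nonneg_ae (.of_forall fun p => (Real.exp_pos _).le) hei.1]
    exact ENNReal.toReal_le_of_le_ofReal zero_le_one (by simpa using hlin)
  -- Jensen in the form Y ≤ exp Y - 1, using that the exponential moment is at most 1.
  have hY0 : ∫ p, Y p ∂M ≤ 0 := by
    calc _ ≤ ∫ p, (Real.exp (Y p) - 1) ∂M :=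
          integral_mono hYi (hei.sub (integrable_const 1)) fun p => by
            change Y p ≤ Real.exp (Y p) - 1
            linarith [Real.add_one_le_exp (Y p)]
      _ ≤ 0 := by
          rw [integral_sub hei (integrable_const 1)]
          simpa using he1
  rw [hYint] at hY0
  linarith

end ModelBasedMDP
end

/-! ### Prior coverage and attainment of the eluder coefficient -/

noncomputable section
namespace ModelBasedMDP

variable {𝓗 S A : Type*} [MeasurableSpace 𝓗] [MeasurableSpace S] [MeasurableSpace A]
  {H : ℕ} {ν : Measure S}

section Omega

variable {truth : MDP S A H ν} {cls : ModelClass 𝓗 S A H ν} {ρ : Measure S} {p₀ : Measure 𝓗}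
  [IsProbabilityMeasure p₀] {c : ℝ}

lemma coverage_term_eq {ε : ℝ} (hK : p₀ (nearTruth truth cls ρ ε) ≠ 0) :
    ((c * ε : ℝ) : EReal) - ENNReal.log (p₀ (nearTruth truth cls ρ ε)) =
      ((c * ε - Real.log (p₀ (nearTruth truth cls ρ ε)).toReal : ℝ) : EReal) := by
  rw [ENNReal.log_pos_real hK (measure_ne_top _ _), EReal.coe_sub]

/-- Radii whose neighbourhood is a null set contribute ⊤ to the infimum, so only positive mass has
to be tested. -/
lemma le_omega {x : ℝ} (h : ∀ ε, 0 < ε → p₀ (nearTruth truth cls ρ ε) ≠ 0 →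
    x ≤ c * ε - Real.log (p₀ (nearTruth truth cls ρ ε)).toReal) :
    (x : EReal) ≤ omega truth cls ρ c p₀ := by
  refine le_iInf₂ fun ε hε => ?_
  by_cases hK : p₀ (nearTruth truth cls ρ ε) = 0
  · rw [hK, ENNReal.log_zero, EReal.coe_sub_bot]
    exact le_top
  · rw [coverage_term_eq hK, EReal.coe_le_coe_iff]
    exact h ε hε hK

lemma omega_le {ε : ℝ} (hε : 0 < ε) (hK : p₀ (nearTruth truth cls ρ ε) ≠ 0) :
    omega truth cls ρ c p₀ ≤
      ((c * ε - Real.log (p₀ (nearTruth truth cls ρ ε)).toReal : ℝ) : EReal) := by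
  rw [← coverage_term_eq hK]
  exact iInf₂_le ε hε

lemma exists_of_omega_lt {b : ℝ} (h : omega truth cls ρ c p₀ < b) : ∃ ε, 0 < ε ∧
    p₀ (nearTruth truth cls ρ ε) ≠ 0 ∧
    c * ε - Real.log (p₀ (nearTruth truth cls ρ ε)).toReal < b := by
  obtain ⟨ε, hε, h⟩ := by simpa only [omega, iInf_lt_iff] using h
  by_cases hK : p₀ (nearTruth truth cls ρ ε) = 0
  · rw [hK, ENNReal.log_zero, EReal.coe_sub_bot] at h
    exact absurd h not_top_lt
  · rw [coverage_term_eq hK, EReal.coe_lt_coe_iff] at h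
    exact ⟨ε, hε, hK, h⟩

lemma log_toReal_measure_nonpos (s : Set 𝓗) : Real.log (p₀ s).toReal ≤ 0 :=
  Real.log_nonpos ENNReal.toReal_nonneg (ENNReal.toReal_le_of_le_ofReal zero_le_one
    (by simpa using prob_le_one))

/-- If the coverage price vanishes, almost all hypotheses are optimistic. -/
lemma ae_optValue_le_of_omega_eq_zero (hV : Measurable fun f => optValue (cls.model f) ρ)
    (hc : 0 < c) (h0 : omega truth cls ρ c p₀ = 0) :
    ∀ᵐ f ∂p₀, optValue truth ρ - optValue (cls.model f) ρ ≤ 0 := by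
  have hA (δ : ℝ) (hδ : 0 < δ) :
      ∀ᵐ f ∂p₀, optValue truth ρ - optValue (cls.model f) ρ ≤ δ := by
    have hms : MeasurableSet {f | optValue truth ρ - optValue (cls.model f) ρ ≤ δ} :=
      measurableSet_le (hV.const_sub _) measurable_const
    have key (τ : ℝ) (hτ : 0 < τ) :
        p₀ {f | optValue truth ρ - optValue (cls.model f) ρ ≤ δ} ≠ 0 ∧
        -τ ≤ Real.log (p₀ {f | optValue truth ρ - optValue (cls.model f) ρ ≤ δ}).toReal := by
      -- Both summands of the coverage price are nonnegative. The bound cδ therefore forces ε ≤ δ,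
      -- and the bound τ forces log p⁰(𝓗(ε)) ≥ -τ, for the same ε.
      have hlt : omega truth cls ρ c p₀ < ((min (c * δ) τ : ℝ) : EReal) := by
        rw [h0]
        exact_mod_cast lt_min (mul_pos hc hδ) hτ
      obtain ⟨ε, hε, hK, hlt⟩ := exists_of_omega_lt hlt
      have h1 := log_toReal_measure_nonpos (p₀ := p₀) (nearTruth truth cls ρ ε)
      have h2 := hlt.trans_le (min_le_left _ _)
      have h3 := hlt.trans_le (min_le_right _ _)
      have h4 : ε ≤ δ := by
        by_contra! hlt'
        nlinarith [mul_lt_mul_of_pos_left hlt' hc]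
      have h5 : nearTruth truth cls ρ ε ⊆
          {f | optValue truth ρ - optValue (cls.model f) ρ ≤ δ} := fun f hf => hf.1.trans h4
      have h6 := Real.log_le_log (ENNReal.toReal_pos hK (measure_ne_top _ _))
        (ENNReal.toReal_mono (measure_ne_top _ _) (measure_mono (μ := p₀) h5))
      have h7 : 0 < c * ε := mul_pos hc hε
      exact ⟨fun h => hK (measure_mono_null h5 h), by linarith⟩
    change p₀ {f | optValue truth ρ - optValue (cls.model f) ρ ≤ δ}ᶜ = 0
    rw [prob_compl_eq_zero_iff hms]
    refine le_antisymm prob_le_one ?_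
    by_contra! hlt
    have h2 : (p₀ {f | optValue truth ρ - optValue (cls.model f) ρ ≤ δ}).toReal < 1 := by
      rw [← ENNReal.toReal_one]
      exact (ENNReal.toReal_lt_toReal (measure_ne_top _ _) ENNReal.one_ne_top).2 hlt
    have h3 := Real.log_neg (ENNReal.toReal_pos (key 1 one_pos).1 (measure_ne_top _ _)) h2
    have h4 := (key _ (half_pos (neg_pos.2 h3))).2
    linarith
  have hall : ∀ᵐ f ∂p₀, ∀ n : ℕ,
      optValue truth ρ - optValue (cls.model f) ρ ≤ 1 / ((n : ℝ) + 1) :=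
    ae_all_iff.2 fun n => hA _ Nat.one_div_pos_of_nat
  filter_upwards [hall] with f hf
  by_contra! hpos
  obtain ⟨n, hn⟩ := exists_nat_one_div_lt hpos
  exact absurd (hf n) (not_le.2 hn)

lemma mem_nearTruth [SigmaFinite ν] {f : 𝓗} (hf : cls.model f = truth) {ε : ℝ} (hε : 0 ≤ ε) :
    f ∈ nearTruth truth cls ρ ε := by
  refine ⟨by rw [hf]; simpa, fun h z => ?_⟩
  have := truth.isProbabilityMeasure_transLaw h z
  rw [hf, InformationTheory.klDiv_self]
  exact zero_le

end Omega

section Uniform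

lemma isProbabilityMeasure_uniformOn_univ [Finite 𝓗] [Nonempty 𝓗] :
    IsProbabilityMeasure (uniformOn (Set.univ : Set 𝓗)) := by
  refine cond_isProbabilityMeasure_of_finite ?_ ?_
  · rw [Measure.count_univ]; simp
  · rw [Measure.count_univ, ENat.card_eq_coe_natCard]; simp

/-- No measurability of s is required, since `Measure.le_count_apply` bounds the counting measure of
an arbitrary set from below. -/
lemma inv_natCard_le_uniformOn_univ [Finite 𝓗] {s : Set 𝓗} (hs : s.Nonempty) :
    (Nat.card 𝓗 : ℝ≥0∞)⁻¹ ≤ uniformOn (Set.univ : Set 𝓗) s := by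
  have h1 : (1 : ℝ≥0∞) ≤ Measure.count s := by
    obtain ⟨f, hf⟩ := hs
    exact (ENNReal.le_tsum (f := fun _ : s => (1 : ℝ≥0∞)) ⟨f, hf⟩).trans Measure.le_count_apply
  rw [uniformOn, cond_apply MeasurableSet.univ, Measure.count_univ, Set.univ_inter,
    ENat.card_eq_coe_natCard]
  calc _ = (Nat.card 𝓗 : ℝ≥0∞)⁻¹ * 1 := (mul_one _).symm
    _ ≤ _ := by gcongr; simp

variable {truth : MDP S A H ν} {cls : ModelClass 𝓗 S A H ν} {ρ : Measure S} {c : ℝ}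

lemma omega_nonneg (hc : 0 ≤ c) (p₀ : Measure 𝓗) [IsProbabilityMeasure p₀] :
    0 ≤ omega truth cls ρ c p₀ := by
  refine le_omega (x := 0) fun ε hε _ => ?_
  linarith [mul_nonneg hc hε.le,
    log_toReal_measure_nonpos (p₀ := p₀) (nearTruth truth cls ρ ε)]

lemma omega_uniformOn_le [SigmaFinite ν] [Finite 𝓗] (hc : 0 ≤ c)
    (realizable : truth ∈ Set.range cls.model) :
    omega truth cls ρ c (uniformOn Set.univ) ≤ (Real.log (Nat.card 𝓗) : ℝ) := by
  obtain ⟨f, hf⟩ := realizable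
  have : Nonempty 𝓗 := ⟨f⟩
  have hP := isProbabilityMeasure_uniformOn_univ (𝓗 := 𝓗)
  have hcard : (0 : ℝ) < Nat.card 𝓗 := by exact_mod_cast Nat.card_pos
  have hbound (δ : ℝ) (hδ : 0 < δ) : omega truth cls ρ c (uniformOn Set.univ) ≤
      ((Real.log (Nat.card 𝓗) + δ : ℝ) : EReal) := by
    -- This radius makes cε ≤ δ even when c = 0, while 𝓗(ε) still contains the truth.
    have hε : 0 < δ / (c + 1) := by positivity
    have h1 := inv_natCard_le_uniformOn_univ (𝓗 := 𝓗)
      ⟨f, mem_nearTruth (ρ := ρ) hf hε.le⟩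
    have h2 : uniformOn Set.univ (nearTruth truth cls ρ (δ / (c + 1))) ≠ 0 :=
      (lt_of_lt_of_le (by simp) h1).ne'
    refine (omega_le hε h2).trans (EReal.coe_le_coe_iff.2 ?_)
    have h3 := ENNReal.toReal_mono (measure_ne_top _ _) h1
    rw [ENNReal.toReal_inv, ENNReal.toReal_natCast] at h3
    have h4 := Real.log_le_log (inv_pos.2 hcard) h3
    rw [Real.log_inv] at h4
    have h5 : c * (δ / (c + 1)) ≤ δ := by
      rw [← mul_div_assoc, div_le_iff₀ (by positivity)]
      nlinarith
    linarith
  refine EReal.le_of_forall_lt_iff_le.1 fun z hz => ?_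
  have hz' := EReal.coe_lt_coe_iff.1 hz
  have := hbound (z - Real.log (Nat.card 𝓗)) (by linarith)
  simpa using this

end Uniform

section GEC

variable (truth : MDP S A H ν) (cls : ModelClass 𝓗 S A H ν) (ρ : Measure S)
  (π : PolicyFamily 𝓗 S A H) (πexp : Fin H → PolicyFamily 𝓗 S A H)

/-- A positive generalized eluder coefficient is attained. -/
lemma gec_spec {T : ℕ} {ε : ℝ} (hpos : 0 < gec truth cls ρ π πexp T ε) (f : Fin T → 𝓗) :
    ∑ t, (optValue (cls.model (f t)) ρ - value truth ρ (π.policy (f t))) ≤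
      Real.sqrt (gec truth cls ρ π πexp T ε *
        ∑ h, ∑ t, ∑ s with s < t, discrepancy truth cls ρ πexp h (f s) (f t))
        + 2 * min (gec truth cls ρ π πexp T ε) (H * T) + ε * H * T := by
  set D := {d : ℝ | 0 ≤ d ∧ ∀ f : Fin T → 𝓗,
    ∑ t, (optValue (cls.model (f t)) ρ - value truth ρ (π.policy (f t))) ≤
      Real.sqrt (d * ∑ h, ∑ t, ∑ s with s < t, discrepancy truth cls ρ πexp h (f s) (f t))
        + 2 * min d (H * T) + ε * H * T} with hD
  -- The infimum of the empty set is 0 in `ℝ`, so positivity of the coefficient excludes an empty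
  -- constraint set.
  have hne : D.Nonempty := by
    by_contra hne
    rw [Set.not_nonempty_iff_eq_empty] at hne
    rw [gec, ← hD, hne, Real.sInf_empty] at hpos
    exact lt_irrefl _ hpos
  have hclosed : IsClosed D := by
    rw [hD, Set.ofPred_and, Set.ofPred_forall]
    refine (isClosed_le continuous_const continuous_id).inter (isClosed_iInter fun f => ?_)
    exact isClosed_le continuous_const (by fun_prop)
  exact (hclosed.csInf_mem hne ⟨0, fun d hd => hd.1⟩).2 f

end GEC

end ModelBasedMDP
end

/-! ### Summing potentials and decomposing the regret -/

noncomputable section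
namespace ModelBasedMDP

variable {𝓗 S A : Type*} [MeasurableSpace 𝓗] [MeasurableSpace S] [MeasurableSpace A]
  {H : ℕ} {ν : Measure S}

section Total

variable (truth : MDP S A H ν) (cls : ModelClass 𝓗 S A H ν) (ρ : Measure S)
  (πexp : Fin H → PolicyFamily 𝓗 S A H) (γ : ℝ)

/-- The potentials of the sampled hypotheses, summed along a run. -/
def totalPotential {T : ℕ} (run : Fin T → Round 𝓗 S A H) : ℝ :=
  ∑ t, (γ * (optValue truth ρ - optValue (cls.model (run t).1) ρ) +
    ∑ s with s < t, roundDiscrepancy truth cls ρ πexp (run s) (run t).1)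

/-- A new round is last in the order, so it adds discrepancies of its own hypothesis against the
past and none to earlier terms. -/
lemma totalPotential_snoc {T : ℕ} (hist : Fin T → Round 𝓗 S A H) (r : Round 𝓗 S A H) :
    totalPotential truth cls ρ πexp γ (Fin.snoc hist r : Fin (T + 1) → Round 𝓗 S A H) =
      totalPotential truth cls ρ πexp γ hist + potential truth cls ρ πexp γ hist r.1 := by
  have hlast (x : Fin T) : ¬ Fin.last T < x.castSucc := (Fin.castSucc_lt_last x).not_gt
  simp [totalPotential, potential, Fin.sum_univ_castSucc, Finset.sum_filter, Fin.castSucc_lt_last,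
    hlast]

variable [SigmaFinite ν] [IsProbabilityMeasure ρ]

lemma measurable_totalPotential (hV : Measurable fun f => optValue (cls.model f) ρ) (T : ℕ) :
    Measurable fun run : Fin T → Round 𝓗 S A H => totalPotential truth cls ρ πexp γ run := by
  refine Finset.measurable_fun_sum _ fun t _ => Measurable.add ?_ ?_
  · exact ((hV.comp (by fun_prop : Measurable fun run : Fin T → Round 𝓗 S A H =>
      (run t).1)).const_sub _).const_mul γ
  · refine Finset.measurable_fun_sum _ fun s _ => ?_
    have h1 : Measurable fun run : Fin T → Round 𝓗 S A H => (run s, (run t).1) := by fun_prop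
    have h2 := (measurable_roundDiscrepancy truth cls ρ πexp).comp h1
    exact h2

lemma integrable_totalPotential (hV : Measurable fun f => optValue (cls.model f) ρ) (T : ℕ)
    (μ : Measure (Fin T → Round 𝓗 S A H)) [IsFiniteMeasure μ] :
    Integrable (fun run => totalPotential truth cls ρ πexp γ run) μ := by
  refine .of_bound (measurable_totalPotential truth cls ρ πexp γ hV T).aestronglyMeasurable
    (∑ _t : Fin T, (|γ| + ∑ _s : Fin T, (H : ℝ))) (.of_forall fun run => ?_)
  refine (Finset.abs_sum_le_sum_abs _ _).trans (Finset.sum_le_sum fun t _ => ?_)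
  refine (abs_add_le _ _).trans (add_le_add ?_ ?_)
  · rw [abs_mul]
    exact mul_le_of_le_one_right (abs_nonneg _) (abs_optValue_sub_le_one ρ _ _)
  · rw [abs_of_nonneg (Finset.sum_nonneg fun s _ =>
      roundDiscrepancy_nonneg truth cls ρ πexp _ _)]
    refine (Finset.sum_le_sum_of_subset_of_nonneg (Finset.subset_univ _) fun s _ _ =>
      roundDiscrepancy_nonneg truth cls ρ πexp _ _).trans (Finset.sum_le_sum fun s _ => ?_)
    exact roundDiscrepancy_le truth cls ρ πexp _ _

variable {truth cls ρ πexp γ} {γ' : ℝ} {p₀ : Measure 𝓗} [IsProbabilityMeasure p₀]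

lemma map_compProd_roundKernel (hV : Measurable fun f => optValue (cls.model f) ρ) (t : ℕ)
    (η : ℝ) :
    (runLaw truth cls ρ πexp γ η p₀ t ⊗ₘ roundKernel truth cls ρ πexp γ η p₀ hV t).map
      (fun p => (p.1, p.2.1)) =
    runLaw truth cls ρ πexp γ η p₀ t ⊗ₘ posteriorKernel cls ρ γ η p₀ hV t := by
  have := isFiniteMeasure_runLaw truth cls ρ πexp γ η p₀ hV t
  have h : posteriorKernel cls ρ γ η p₀ hV t =
      (roundKernel truth cls ρ πexp γ η p₀ hV t).map Prod.fst := by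
    rw [← Kernel.fst_eq, roundKernel, Kernel.fst_compProd]
  rw [h, Measure.compProd_map measurable_fst]
  rfl

/-- The coefficient γ' of the potential is kept separate from the γ that drives the sampling. The
case ω = 0, where sampling uses γ = 0, needs a positive γ' to divide by. -/
lemma integral_totalPotential_le (hV : Measurable fun f => optValue (cls.model f) ρ)
    (hn : ∀ u, Normalizes truth cls ρ πexp γ (1 / 2) p₀ u) {b : ℝ} (T : ℕ)
    (hb : ∀ t < T, ∫ q, potential truth cls ρ πexp γ' q.1 q.2
      ∂(runLaw truth cls ρ πexp γ (1 / 2) p₀ t ⊗ₘ posteriorKernel cls ρ γ (1 / 2) p₀ hV t) ≤ b) :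
    ∫ run, totalPotential truth cls ρ πexp γ' run ∂(runLaw truth cls ρ πexp γ (1 / 2) p₀ T)
      ≤ T * b := by
  induction T with
  | zero => simp [totalPotential]
  | succ T ih =>
    have := isFiniteMeasure_runLaw truth cls ρ πexp γ (1 / 2) p₀ hV T
    have hm := measurable_totalPotential truth cls ρ πexp γ' hV
    have hmF : Measurable fun q : (Fin T → Round 𝓗 S A H) × 𝓗 =>
        totalPotential truth cls ρ πexp γ' q.1 + potential truth cls ρ πexp γ' q.1 q.2 :=
      ((hm T).comp measurable_fst).add (measurable_potential truth cls ρ πexp γ' hV T)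
    have hfst := map_fst_compProd_posteriorKernel hV (hn T)
    rw [runLaw_succ truth cls ρ πexp γ (1 / 2) p₀ hV T,
      integral_map (measurable_finSnoc T).aemeasurable (hm (T + 1)).aestronglyMeasurable]
    simp_rw [totalPotential_snoc]
    have hproj : Measurable fun p : (Fin T → Round 𝓗 S A H) × Round 𝓗 S A H =>
        (p.1, p.2.1) := by fun_prop
    rw [← integral_map (f := fun q : (Fin T → Round 𝓗 S A H) × 𝓗 =>
        totalPotential truth cls ρ πexp γ' q.1 + potential truth cls ρ πexp γ' q.1 q.2)
        hproj.aemeasurable hmF.aestronglyMeasurable, map_compProd_roundKernel hV T]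
    have hi : Integrable (fun q : (Fin T → Round 𝓗 S A H) × 𝓗 =>
        totalPotential truth cls ρ πexp γ' q.1)
        (runLaw truth cls ρ πexp γ (1 / 2) p₀ T ⊗ₘ posteriorKernel cls ρ γ (1 / 2) p₀ hV T) := by
      have h1 := integrable_totalPotential truth cls ρ πexp γ' hV T
        (runLaw truth cls ρ πexp γ (1 / 2) p₀ T)
      rw [← hfst] at h1
      exact h1.comp_measurable measurable_fst
    rw [integral_add hi (integrable_potential truth cls ρ πexp γ' hV T _),
      ← integral_map (f := fun hist => totalPotential truth cls ρ πexp γ' hist)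
        measurable_fst.aemeasurable (hm T).aestronglyMeasurable, hfst]
    have h2 := ih fun t ht => hb t (by omega)
    have h3 := hb T (by omega)
    push_cast
    linarith

end Total

section Regret

variable {truth : MDP S A H ν} {cls : ModelClass 𝓗 S A H ν} {ρ : Measure S}
  {π : PolicyFamily 𝓗 S A H} {πexp : Fin H → PolicyFamily 𝓗 S A H}

/-- AM-GM applied to x/g and dg/4. The scale g is the coefficient of the optimism gap, so x/g joins
the gaps to form `totalPotential` / g. -/
lemma sqrt_mul_le_div_add {x d g : ℝ} (hx : 0 ≤ x) (hd : 0 ≤ d) (hg : 0 < g) :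
    Real.sqrt (d * x) ≤ x / g + d * g / 4 := by
  refine Real.sqrt_le_iff.2 ⟨by positivity, ?_⟩
  have h : d * x = 4 * ((x / g) * (d * g / 4)) := by field_simp
  nlinarith [sq_nonneg (x / g - d * g / 4)]

/-- Regret decomposition through the generalized eluder coefficient. -/
lemma regret_le {T : ℕ} {ε : ℝ} (hpos : 0 < gec truth cls ρ π πexp T ε) {g : ℝ} (hg : 0 < g)
    (run : Fin T → Round 𝓗 S A H) :
    regret truth ρ π run ≤ totalPotential truth cls ρ πexp g run / g +
      gec truth cls ρ π πexp T ε * g / 4 + 2 * min (gec truth cls ρ π πexp T ε) (H * T)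
        + ε * H * T := by
  have h1 := gec_spec truth cls ρ π πexp hpos fun t => (run t).1
  set x := ∑ h, ∑ t, ∑ s with s < t, discrepancy truth cls ρ πexp h (run s).1 (run t).1 with hx
  have hx0 : 0 ≤ x := Finset.sum_nonneg fun h _ => Finset.sum_nonneg fun t _ =>
    Finset.sum_nonneg fun s _ => discrepancy_nonneg truth cls ρ πexp h _ _
  have hxr : x = ∑ t, ∑ s with s < t, roundDiscrepancy truth cls ρ πexp (run s) (run t).1 := by
    rw [hx, Finset.sum_comm]
    refine Finset.sum_congr rfl fun t _ => ?_
    rw [Finset.sum_comm]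
    rfl
  have h2 := sqrt_mul_le_div_add hx0 hpos.le hg
  have h3 : totalPotential truth cls ρ πexp g run / g =
      ∑ t, (optValue truth ρ - optValue (cls.model (run t).1) ρ) + x / g := by
    rw [totalPotential, Finset.sum_add_distrib, ← Finset.mul_sum, ← hxr, add_div,
      mul_div_cancel_left₀ _ hg.ne']
  have h4 : regret truth ρ π run =
      ∑ t, (optValue truth ρ - optValue (cls.model (run t).1) ρ) +
      ∑ t, (optValue (cls.model (run t).1) ρ - value truth ρ (π.policy (run t).1)) := by
    rw [← Finset.sum_add_distrib, regret]
    exact Finset.sum_congr rfl fun t _ => by ring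
  rw [h3, h4]
  linarith

variable [SigmaFinite ν] [IsProbabilityMeasure ρ]

lemma abs_regret_le {T : ℕ} (run : Fin T → Round 𝓗 S A H) : |regret truth ρ π run| ≤ T := by
  refine (Finset.abs_sum_le_sum_abs _ _).trans ?_
  calc _ ≤ ∑ _t : Fin T, (1 : ℝ) := Finset.sum_le_sum fun t _ => abs_le.2
        ⟨by linarith [optValue_nonneg truth ρ, value_le_one truth ρ (π.policy (run t).1)],
          by linarith [value_nonneg truth ρ (π.policy (run t).1), optValue_le_one truth ρ]⟩
    _ = T := by simp

lemma integrable_regret {T : ℕ} (μ : Measure (Fin T → Round 𝓗 S A H)) [IsFiniteMeasure μ] :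
    Integrable (fun run => regret truth ρ π run) μ := by
  refine .of_bound (Measurable.aestronglyMeasurable ?_) T (.of_forall abs_regret_le)
  refine Finset.measurable_fun_sum _ fun t _ => Measurable.const_sub ?_ _
  exact (measurable_value (truth.constClass 𝓗) ρ π).comp
    (by fun_prop : Measurable fun run : Fin T → Round 𝓗 S A H => (run t).1)

end Regret

end ModelBasedMDP
end

/-! ### Regret bounds, including the degenerate cases -/

noncomputable section
namespace ModelBasedMDP

variable {𝓗 S A : Type*} [MeasurableSpace 𝓗] [MeasurableSpace S] [MeasurableSpace A]
  {H : ℕ} {ν : Measure S} {truth : MDP S A H ν} {cls : ModelClass 𝓗 S A H ν}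
  {ρ : Measure S} {π : PolicyFamily 𝓗 S A H}
  {πexp : Fin H → PolicyFamily 𝓗 S A H} {p₀ : Measure 𝓗} {γ : ℝ}

lemma regret_eq_zero_of_horizon_eq_zero (hH : H = 0) {T : ℕ} (run : Fin T → Round 𝓗 S A H) :
    regret truth ρ π run = 0 := by
  subst hH
  have h1 (π' : Policy S A 0) : value truth ρ π' = 0 := by simp [value]
  have h2 : optValue truth ρ = 0 :=
    le_antisymm (Real.sSup_le (by rintro _ ⟨π', rfl⟩; exact (h1 π').le) le_rfl)
      (optValue_nonneg truth ρ)
  simp [regret, h1, h2]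

/-- Realizability makes the only hypothesis the truth, so the executed policy is optimal. This
covers log |𝓗| = 0, for which the bound is zero. -/
lemma regret_eq_zero_of_subsingleton [Subsingleton 𝓗] (hπ : IsOptimalFamily cls ρ π)
    (realizable : truth ∈ Set.range cls.model) {T : ℕ} (run : Fin T → Round 𝓗 S A H) :
    regret truth ρ π run = 0 := by
  obtain ⟨f, rfl⟩ := realizable
  refine Finset.sum_eq_zero fun t _ => ?_
  rw [Subsingleton.elim (run t).1 f, hπ.optValue_eq, sub_self]

lemma expectedRegret_bounds_of_regret_eq_zero {T : ℕ} {d ℓ : ℝ}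
    (h : ∀ run : Fin T → Round 𝓗 S A H, regret truth ρ π run = 0) :
    expectedRegret truth cls ρ π πexp γ (1 / 2) p₀ T ≤ 4 * Real.sqrt (d * H * T * ℓ) ∧
      H * expectedRegret truth cls ρ π πexp γ (1 / 2) p₀ T
        ≤ 4 * Real.sqrt (d * H * (H * T) * ℓ) := by
  have h0 : expectedRegret truth cls ρ π πexp γ (1 / 2) p₀ T = 0 := by simp [expectedRegret, h]
  rw [h0, mul_zero]
  constructor <;> positivity

variable [SigmaFinite ν] [IsProbabilityMeasure ρ]

lemma expectedRegret_le_horizon {T : ℕ}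
    [IsProbabilityMeasure (runLaw truth cls ρ πexp γ (1 / 2) p₀ T)] :
    expectedRegret truth cls ρ π πexp γ (1 / 2) p₀ T ≤ T := by
  calc _ ≤ ∫ _, (T : ℝ) ∂(runLaw truth cls ρ πexp γ (1 / 2) p₀ T) :=
        integral_mono (integrable_regret _) (integrable_const _) fun run =>
          (abs_le.1 (abs_regret_le run)).2
    _ = T := by rw [integral_const, probReal_univ, one_smul]

lemma expectedRegret_le_of_integral_totalPotential_le
    (hV : Measurable fun f => optValue (cls.model f) ρ) {T : ℕ} {ε : ℝ}
    [IsProbabilityMeasure (runLaw truth cls ρ πexp γ (1 / 2) p₀ T)]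
    (hpos : 0 < gec truth cls ρ π πexp T ε) {g b : ℝ} (hg : 0 < g)
    (hb : ∫ run, totalPotential truth cls ρ πexp g run
      ∂(runLaw truth cls ρ πexp γ (1 / 2) p₀ T) ≤ b) :
    expectedRegret truth cls ρ π πexp γ (1 / 2) p₀ T ≤ b / g +
      gec truth cls ρ π πexp T ε * g / 4 + 2 * min (gec truth cls ρ π πexp T ε) (H * T)
        + ε * H * T := by
  have hi := integrable_totalPotential truth cls ρ πexp g hV T
    (runLaw truth cls ρ πexp γ (1 / 2) p₀ T)
  set k := gec truth cls ρ π πexp T ε * g / 4 + 2 * min (gec truth cls ρ π πexp T ε) (H * T)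
        + ε * H * T with hk
  calc _ ≤ ∫ run, (totalPotential truth cls ρ πexp g run / g + k)
          ∂(runLaw truth cls ρ πexp γ (1 / 2) p₀ T) :=
        integral_mono (integrable_regret _) ((hi.div_const g).add (integrable_const k)) fun run =>
          (regret_le hpos hg run).trans (by simp only [hk]; linarith)
    _ = (∫ run, totalPotential truth cls ρ πexp g run
          ∂(runLaw truth cls ρ πexp γ (1 / 2) p₀ T)) / g + k := by
        rw [integral_add (hi.div_const g) (integrable_const k), integral_div, integral_const,
          probReal_univ, one_smul]
    _ ≤ b / g + k := by gcongr
    _ = _ := by rw [hk]; ring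

variable [IsProbabilityMeasure p₀]

lemma normalizes_of_omega_eq_coe (hV : Measurable fun f => optValue (cls.model f) ρ) {c ω : ℝ}
    (hω : (ω : EReal) = omega truth cls ρ c p₀) (u : ℕ) :
    Normalizes truth cls ρ πexp γ (1 / 2) p₀ u := by
  have hlt : omega truth cls ρ c p₀ < ((ω + 1 : ℝ) : EReal) := by
    rw [← hω]
    exact_mod_cast lt_add_one ω
  obtain ⟨ε, -, hK, -⟩ := exists_of_omega_lt hlt
  exact normalizes hV hK u

lemma isWellDefinedRun_of_omega_eq_coe (hV : Measurable fun f => optValue (cls.model f) ρ)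
    {c ω : ℝ} (hω : (ω : EReal) = omega truth cls ρ c p₀) (T : ℕ) :
    IsWellDefinedRun truth cls ρ π πexp γ (1 / 2) p₀ T := by
  have := isProbabilityMeasure_runLaw hV T fun u _ =>
    normalizes_of_omega_eq_coe (πexp := πexp) (γ := γ) hV hω u
  exact ⟨this, integrable_regret _⟩

/-- The estimate γε + tHε/2 - log p⁰(𝓗(ε)) holds for every ε, and the condition on c bounds it by
the corresponding term of the infimum. -/
lemma integral_potential_le_omega (hV : Measurable fun f => optValue (cls.model f) ρ)
    (hγ : 0 ≤ γ) {c ω : ℝ} (hω : (ω : EReal) = omega truth cls ρ c p₀) (t : ℕ)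
    (hc : γ + t * H / 2 ≤ c) :
    ∫ q, potential truth cls ρ πexp γ q.1 q.2
      ∂(runLaw truth cls ρ πexp γ (1 / 2) p₀ t ⊗ₘ posteriorKernel cls ρ γ (1 / 2) p₀ hV t)
      ≤ ω := by
  rw [← EReal.coe_le_coe_iff, hω]
  refine le_omega fun ε hε hK => (integral_potential_le hV hγ t hε.le hK).trans ?_
  nlinarith

/-- The posterior is absolutely continuous with respect to the prior, so the sample is almost surely
optimistic and raising the coefficient of V* - V_f from 0 only lowers the potential. -/
lemma integral_potential_le_of_ae_optimistic
    (hV : Measurable fun f => optValue (cls.model f) ρ) (t : ℕ) {g : ℝ} (hg : 0 ≤ g)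
    (hopt : ∀ᵐ f ∂p₀, optValue truth ρ - optValue (cls.model f) ρ ≤ 0) :
    ∫ q, potential truth cls ρ πexp g q.1 q.2
      ∂(runLaw truth cls ρ πexp γ (1 / 2) p₀ t ⊗ₘ posteriorKernel cls ρ γ (1 / 2) p₀ hV t)
      ≤ ∫ q, potential truth cls ρ πexp 0 q.1 q.2
      ∂(runLaw truth cls ρ πexp γ (1 / 2) p₀ t ⊗ₘ posteriorKernel cls ρ γ (1 / 2) p₀ hV t) := by
  have := isFiniteMeasure_runLaw truth cls ρ πexp γ (1 / 2) p₀ hV t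
  refine integral_mono_ae (integrable_potential truth cls ρ πexp g hV t _)
    (integrable_potential truth cls ρ πexp 0 hV t _) ?_
  have hms : MeasurableSet {q : (Fin t → Round 𝓗 S A H) × 𝓗 |
      optValue truth ρ - optValue (cls.model q.2) ρ ≤ 0} :=
    measurableSet_le ((hV.comp measurable_snd).const_sub _) measurable_const
  have hae := Measure.ae_compProd_of_ae_ae (μ := runLaw truth cls ρ πexp γ (1 / 2) p₀ t)
    (κ := posteriorKernel cls ρ γ (1 / 2) p₀ hV t) hms
    (.of_forall fun hist => withDensity_absolutelyContinuous _ _ hopt)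
  filter_upwards [hae] with q hq
  simp only [potential]
  nlinarith

/-- The regret bound, free of the horizon, for any upper bound `ℓ ≥ 1/2` of the coverage. -/
theorem expectedRegret_le (hV : Measurable fun f => optValue (cls.model f) ρ) (hH : 1 ≤ H)
    {T : ℕ} {d ω ℓ : ℝ} (hd : d = gec truth cls ρ π πexp T (1 / Real.sqrt ((H : ℝ) ^ 2 * T)))
    (hd_one : 1 ≤ d) (hdT : d ≤ T) (hω : (ω : EReal) = omega truth cls ρ ((H : ℝ) * T) p₀)
    (hω0 : 0 ≤ ω) (hωℓ : ω ≤ ℓ) (hℓ : 1 / 2 ≤ ℓ) (hγ : γ = 2 * Real.sqrt (ω * T / d)) :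
    expectedRegret truth cls ρ π πexp γ (1 / 2) p₀ T ≤ 4 * Real.sqrt (d * T * ℓ) := by
  have hn := normalizes_of_omega_eq_coe (πexp := πexp) (γ := γ) hV hω
  have := isProbabilityMeasure_runLaw hV T fun u _ => hn u
  have hT : (1 : ℝ) ≤ T := hd_one.trans hdT
  have hd0 : 0 < d := by linarith
  have hH' : (1 : ℝ) ≤ H := by exact_mod_cast hH
  -- In the first regime T ≤ 4√(dTℓ), so bounding the regret by T is enough. In the second, T > 16dℓ
  -- makes γ and the burn-in small.
  rcases le_or_gt (T : ℝ) (16 * d * ℓ) with hle | hgt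
  · refine expectedRegret_le_horizon.trans ?_
    have h1 : (T : ℝ) ≤ Real.sqrt (16 * (d * T * ℓ)) :=
      Real.le_sqrt_of_sq_le (by nlinarith)
    rwa [Real.sqrt_mul (by norm_num), show Real.sqrt 16 = 4 by
      rw [show (16 : ℝ) = 4 ^ 2 by norm_num]; exact Real.sqrt_sq (by norm_num)] at h1
  set R := Real.sqrt (d * T * ℓ) with hR
  have hγ0 : 0 ≤ γ := by rw [hγ]; positivity
  -- Together with t ≤ T and H ≥ 1 this gives γ + tH/2 ≤ HT, the condition for comparison with ω(HT,
  -- p⁰).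
  have hγT : γ ≤ T / 2 := by
    have h1 : Real.sqrt (ω * T / d) ≤ T / 4 := by
      rw [Real.sqrt_le_left (by positivity), div_le_iff₀ hd0]
      have h2 : 16 * ω ≤ T * d := by nlinarith
      nlinarith
    linarith
  have hstep (t : ℕ) (ht : t < T) : ∫ q, potential truth cls ρ πexp γ q.1 q.2
      ∂(runLaw truth cls ρ πexp γ (1 / 2) p₀ t ⊗ₘ posteriorKernel cls ρ γ (1 / 2) p₀ hV t)
      ≤ ω := by
    refine integral_potential_le_omega hV hγ0 hω t ?_
    have h1 : (t : ℝ) ≤ T := by exact_mod_cast ht.le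
    nlinarith
  have hmain : ∃ g b : ℝ, 0 < g ∧ b / g + d * g / 4 ≤ R ∧
      ∫ run, totalPotential truth cls ρ πexp g run
        ∂(runLaw truth cls ρ πexp γ (1 / 2) p₀ T) ≤ b := by
    rcases hω0.eq_or_lt with h0 | hpos
    -- Here γ = 0 cannot serve as a divisor. Almost all hypotheses are optimistic, so a scale built
    -- from ℓ can be used: the total potential has mean at most 0, and dg/4 = R/2.
    · have hg : 0 < 2 * Real.sqrt (ℓ * T / d) := by positivity
      refine ⟨2 * Real.sqrt (ℓ * T / d), T * 0, hg, ?_,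
        integral_totalPotential_le hV hn T fun t ht => ?_⟩
      · have h1 : d * Real.sqrt (ℓ * T / d) = R := by
          rw [hR, ← Real.sqrt_sq hd0.le, ← Real.sqrt_mul (sq_nonneg d), Real.sqrt_sq hd0.le]
          congr 1
          field_simp
        have h2 : 0 ≤ R := Real.sqrt_nonneg _
        rw [mul_zero, zero_div]
        linarith
      · have hopt := ae_optValue_le_of_omega_eq_zero hV (by positivity)
          (by rw [← hω, ← h0]; rfl : omega truth cls ρ ((H : ℝ) * T) p₀ = 0)
        refine (integral_potential_le_of_ae_optimistic hV t hg.le hopt).trans ?_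
        have h1 := hstep t ht
        rw [← h0] at h1
        have h2 : γ = 0 := by rw [hγ, ← h0]; simp
        rwa [h2] at h1 ⊢
    · have hu : 0 < Real.sqrt (ω * T / d) := by positivity
      refine ⟨γ, T * ω, by rw [hγ]; positivity, ?_, integral_totalPotential_le hV hn T hstep⟩
      have h1 : Real.sqrt (ω * T / d) ^ 2 * d = ω * T := by
        rw [Real.sq_sqrt (by positivity)]
        field_simp
      have h2 : T * ω / γ + d * γ / 4 = d * Real.sqrt (ω * T / d) := by
        rw [hγ, mul_comm (T : ℝ)]
        generalize Real.sqrt (ω * T / d) = u at hu h1 ⊢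
        rw [← h1]
        field_simp
        ring
      rw [h2]
      refine Real.le_sqrt_of_sq_le ?_
      nlinarith [mul_le_mul_of_nonneg_left hωℓ (by positivity : 0 ≤ d * (T : ℝ))]
  obtain ⟨g, b, hg, hgb, hb⟩ := hmain
  have hreg := expectedRegret_le_of_integral_totalPotential_le (π := π)
    (ε := 1 / Real.sqrt ((H : ℝ) ^ 2 * T)) hV (hd ▸ hd0) hg hb
  rw [← hd] at hreg
  -- From T > 16dℓ and ℓ ≥ 1/2 follows Tℓ ≥ 16dℓ² ≥ 4d, hence (2d)² ≤ dTℓ.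
  have h1 : 2 * min d (H * T) ≤ R := by
    refine (mul_le_mul_of_nonneg_left (min_le_left _ _) zero_le_two).trans
      (Real.le_sqrt_of_sq_le ?_)
    have : 4 * d ≤ T * ℓ := by nlinarith
    nlinarith
  -- The choice of ε turns this term into √T, and 4dℓ ≥ 1 bounds it by 2R.
  have h2 : 1 / Real.sqrt ((H : ℝ) ^ 2 * T) * H * T ≤ 2 * R := by
    have h3 : 1 / Real.sqrt ((H : ℝ) ^ 2 * T) * H * T = Real.sqrt T := by
      rw [Real.sqrt_mul (sq_nonneg _), Real.sqrt_sq (by positivity)]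
      have h4 : 0 < Real.sqrt (T : ℝ) := Real.sqrt_pos.2 (by linarith)
      have h5 := Real.mul_self_sqrt (show (0 : ℝ) ≤ T by linarith)
      field_simp
      linarith
    rw [h3, Real.sqrt_le_left (by positivity), mul_pow, hR, Real.sq_sqrt (by positivity)]
    have : 1 ≤ 4 * (d * ℓ) := by nlinarith
    nlinarith
  linarith

/-- For H ≥ 1 both forms come from the horizon-free bound: the first by inserting H under the root,
the second by pulling H² out of it. For H = 0 the regret vanishes. -/
lemma expectedRegret_bounds (hV : Measurable fun f => optValue (cls.model f) ρ)
    {T : ℕ} {d ω ℓ : ℝ} (hd : d = gec truth cls ρ π πexp T (1 / Real.sqrt ((H : ℝ) ^ 2 * T)))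
    (hd_one : 1 ≤ d) (hdT : d ≤ T) (hω : (ω : EReal) = omega truth cls ρ ((H : ℝ) * T) p₀)
    (hω0 : 0 ≤ ω) (hωℓ : ω ≤ ℓ) (hℓ : 1 / 2 ≤ ℓ) (hγ : γ = 2 * Real.sqrt (ω * T / d)) :
    expectedRegret truth cls ρ π πexp γ (1 / 2) p₀ T ≤ 4 * Real.sqrt (d * H * T * ℓ) ∧
      H * expectedRegret truth cls ρ π πexp γ (1 / 2) p₀ T
        ≤ 4 * Real.sqrt (d * H * (H * T) * ℓ) := by
  rcases Nat.eq_zero_or_pos H with hH | hH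
  · exact expectedRegret_bounds_of_regret_eq_zero fun run =>
      regret_eq_zero_of_horizon_eq_zero hH run
  have hmain := expectedRegret_le hV hH hd hd_one hdT hω hω0 hωℓ hℓ hγ
  have hH' : (1 : ℝ) ≤ H := by exact_mod_cast hH
  have hd0 : 0 < d := by linarith
  have hT : (0 : ℝ) < T := by linarith
  have hℓ0 : 0 < ℓ := by linarith
  constructor
  · refine hmain.trans (mul_le_mul_of_nonneg_left (Real.sqrt_le_sqrt ?_) (by norm_num))
    have : 0 < d * T * ℓ := by positivity
    nlinarith
  · have h1 : d * H * (H * T) * ℓ = (H : ℝ) ^ 2 * (d * T * ℓ) := by ring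
    rw [h1, Real.sqrt_mul (sq_nonneg _), Real.sqrt_sq (by positivity)]
    nlinarith

end ModelBasedMDP
end

/-! ### The main theorem -/

open ModelBasedMDP
theorem mainTheorem2 {𝓗 S A : Type*} [MeasurableSpace 𝓗] [MeasurableSpace S] [MeasurableSpace A]
    {H : ℕ} (ν : Measure S) [SigmaFinite ν] (ρ : Measure S) [IsProbabilityMeasure ρ]
    (truth : MDP S A H ν) (cls : ModelClass 𝓗 S A H ν)
    (realizable : truth ∈ Set.range cls.model)
    (π : PolicyFamily 𝓗 S A H) (hπ : IsOptimalFamily cls ρ π)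
    (πexp : Fin H → PolicyFamily 𝓗 S A H) (hexp : IsQType π πexp ∨ IsVType π πexp)
    (T : ℕ) (d : ℝ) (hd : d = gec truth cls ρ π πexp T (1 / Real.sqrt ((H : ℝ) ^ 2 * T)))
    (hd_one : 1 ≤ d) (hdT : d ≤ T) :
    (∀ (p₀ : Measure 𝓗) [IsProbabilityMeasure p₀] (ω γ : ℝ),
      (ω : EReal) = omega truth cls ρ ((H : ℝ) * T) p₀ → 1 / 2 ≤ ω →
      γ = 2 * Real.sqrt (ω * T / d) →
      IsWellDefinedRun truth cls ρ π πexp γ (1 / 2) p₀ T ∧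
      expectedRegret truth cls ρ π πexp γ (1 / 2) p₀ T ≤ 4 * Real.sqrt (d * H * T * ω) ∧
      H * expectedRegret truth cls ρ π πexp γ (1 / 2) p₀ T
        ≤ 4 * Real.sqrt (d * H * (H * T) * ω)) ∧
    (Finite 𝓗 → ∀ (p₀ : Measure 𝓗) (γ : ℝ), p₀ = uniformOn Set.univ →
      γ = 2 * Real.sqrt ((omega truth cls ρ ((H : ℝ) * T) p₀).toReal * T / d) →
      IsWellDefinedRun truth cls ρ π πexp γ (1 / 2) p₀ T ∧
      expectedRegret truth cls ρ π πexp γ (1 / 2) p₀ T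
        ≤ 4 * Real.sqrt (d * H * T * Real.log (Nat.card 𝓗)) ∧
      H * expectedRegret truth cls ρ π πexp γ (1 / 2) p₀ T
        ≤ 4 * Real.sqrt (d * H * (H * T) * Real.log (Nat.card 𝓗))) := by
  have hV := hπ.measurable_optValue
  refine ⟨fun p₀ _ ω γ hω hω_half hγ => ⟨isWellDefinedRun_of_omega_eq_coe hV hω T,
    expectedRegret_bounds hV hd hd_one hdT hω (by linarith) le_rfl hω_half hγ⟩, ?_⟩
  rintro hfin p₀ γ rfl hγ
  have hne : Nonempty 𝓗 := ⟨realizable.choose⟩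
  have := isProbabilityMeasure_uniformOn_univ (𝓗 := 𝓗)
  have hω0 : 0 ≤ omega truth cls ρ ((H : ℝ) * T) (uniformOn Set.univ) :=
    omega_nonneg (by positivity) _
  have hωn : omega truth cls ρ ((H : ℝ) * T) (uniformOn Set.univ) ≤ (Real.log (Nat.card 𝓗) : ℝ) :=
    omega_uniformOn_le (by positivity) realizable
  have hω := EReal.coe_toReal (ne_top_of_le_ne_top (EReal.coe_ne_top _) hωn)
    (ne_bot_of_le_ne_bot EReal.zero_ne_bot hω0)
  refine ⟨isWellDefinedRun_of_omega_eq_coe hV hω T, ?_⟩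
  -- Taking ℓ = log |𝓗| requires ℓ ≥ 1/2, which log 2 > 1/2 provides from two hypotheses on; a
  -- single hypothesis has zero regret.
  rcases Nat.lt_or_ge (Nat.card 𝓗) 2 with hcard | hcard
  · have : Subsingleton 𝓗 := (Finite.card_le_one_iff_subsingleton).1 (by omega)
    exact expectedRegret_bounds_of_regret_eq_zero fun run =>
      regret_eq_zero_of_subsingleton hπ realizable run
  · refine expectedRegret_bounds hV hd hd_one hdT hω (EReal.toReal_nonneg hω0) ?_ ?_ hγ
    · rwa [← hω, EReal.coe_le_coe_iff] at hωn
    · have h1 : Real.log 2 ≤ Real.log (Nat.card 𝓗) :=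
        Real.log_le_log (by norm_num) (by exact_mod_cast hcard)
      linarith [Real.log_two_gt_d9]
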